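/- Let $d,m\ge 1$, let $g_1,\dots,g_m\in\mathbb S^{d-1}$ be fixed unit vectors of $\mathbb R^d$ with $\sum_i g_i\neq 0$, and put $$g=\frac{\sum_i g_i}{\|\sum_i g_i\|_2},\qquad \Delta_{\rm corr}=\frac1{m\pi}\sum_{i=1}^m\arccos\langle g_i,g\rangle .$$ Let $z_1,\dots,z_m$ be independent and uniformly distributed on $\mathbb S^{d-1}$. In the OneBit scheme, client $i$ sends the bit $\tilde b_i={\rm sign}\langle g_i,z_i\rangle$, where ${\rm sign}(x)=1$ for $x\ge 0$ and ${\rm sign}(x)=-1$ for $x<0$, and (Technique II) the server, which knows $z_1,\dots,z_m$, outputs $\tilde g=g'/\|g'\|_2$, where $g'=\frac1m\sum_{i=1}^m\tilde b_i z_i$. Let $\zeta$ be the fraction of the indices $i$ with ${\rm sign}\langle z_i,g_i\rangle\ne{\rm sign}\langle g,z_i\rangle$. Theorem. There are universal constants $K,C>0$ such that for all such $d,m,g_1,\dots,g_m$ and all $\delta\in(0,1)$, with probability at least $1-\delta-C\exp(-m\Delta_{\rm corr})$ the vector $\tilde g$ is well defined (that is, $g'\ne0$, so $\|\tilde g\|_2=1$)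 and $$\langle\tilde g,g\rangle\;\ge\;\cos\Big(\min\Big\{\pi,\ \pi\Big(K\sqrt d\,\Delta_{\rm corr}+\frac{d}{\sqrt m}\sqrt{\log\frac d\delta}\Big)\Big\}\Big).$$ This holds for the probability over $z_1,\dots,z_m$, and also for the conditional probability given the event $\{\zeta<\frac12\}$, whenever that event has positive probability. -/

import Mathlib

open MeasureTheory ProbabilityTheory
open scoped InnerProductSpace

noncomputable section

namespace OneBit

/-- The sign convention `sign x = +1` if `x ≥ 0` and `-1` otherwise. -/
def sgn (x : ℝ) : ℝ := if 0 ≤ x then 1 else -1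

/-- `ℝ^d` with the Euclidean norm. -/
abbrev Vec (d : ℕ) := EuclideanSpace ℝ (Fin d)

/-- The unit sphere `S^{d-1}` of `ℝ^d`. -/
abbrev Sphere (d : ℕ) := Metric.sphere (0 : Vec d) 1

/-- The uniform distribution on `S^{d-1}`: the surface measure divided by its total mass. -/
def unifSphere (d : ℕ) : Measure (Sphere d) :=
  ((volume : Measure (Vec d)).toSphere Set.univ)⁻¹ • (volume : Measure (Vec d)).toSphere

variable {d m : ℕ}

/-- The average `(1/m) ∑ g_i`. -/
def avg (v : Fin m → Vec d) : Vec d := (m : ℝ)⁻¹ • ∑ i, v i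

/-- The vector `v / ‖v‖`. -/
def normalize (v : Vec d) : Vec d := ‖v‖⁻¹ • v

/-- The target: the unit vector in the direction of the average of the client vectors. -/
def target (g : Fin m → Sphere d) : Vec d := normalize (avg fun i => (g i : Vec d))

/-- The bit sent by a client that holds `gi`, with shared vector `zi`. -/
def encode (gi zi : Sphere d) : ℝ := sgn ⟪(gi : Vec d), (zi : Vec d)⟫_ℝ

/-- Decoding by averaging: from the bits `b_i` and the shared vectors `z_i`, form
`g' = (1/m) ∑ b_i z_i` and return `g' / ‖g'‖`. -/
def decode (z : Fin m → Sphere d) (b : Fin m → ℝ) : Vec d :=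
  normalize (avg fun i => b i • (z i : Vec d))

/-- The output of the scheme on the client vectors `g` and the shared vectors `z`. -/
def output (g z : Fin m → Sphere d) : Vec d := decode z fun i => encode (g i) (z i)

/-- `Δ_corr = (1/(mπ)) ∑ arccos ⟨g_i, g⟩`. -/
def deltaCorr (g : Fin m → Sphere d) : ℝ :=
  1 / (m * Real.pi) * ∑ i, Real.arccos ⟪(g i : Vec d), target g⟫_ℝ

open Classical in
/-- `ζ`: the fraction of the indices `i` with `sign ⟨z_i, g_i⟩ ≠ sign ⟨g, z_i⟩`. -/
def zeta (g z : Fin m → Sphere d) : ℝ :=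
  ((Finset.univ.filter fun i : Fin m =>
    encode (g i) (z i) ≠ sgn ⟪target g, (z i : Vec d)⟫_ℝ).card : ℝ) / m

/-- The quantity `π (K √d Δ_corr + (d/√m) √(log (d/δ)))` bounding the angular error. -/
def errorBound (K δ : ℝ) (g : Fin m → Sphere d) : ℝ :=
  Real.pi * (K * (√(d : ℝ) * deltaCorr g) + d / √(m : ℝ) * √(Real.log (d / δ)))

/-- The decoder returns a unit vector `g̃` with `⟨g̃, g⟩ ≥ cos (min {π, errorBound})`,
i.e. at an angle of at most `errorBound` from `g`. -/
def Success (K δ : ℝ) (g z : Fin m → Sphere d) : Prop :=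
  ‖output g z‖ = 1 ∧
    Real.cos (min Real.pi (errorBound K δ g)) ≤ ⟪output g z, target g⟫_ℝ

end OneBit

end

namespace OneBit

/-! Let `e` be the target and `x` the sum of the vectors `sgn ⟪g i, z i⟫ • z i`; the output is `x`
normalised. If every bit agreed with `sgn ⟪e, z i⟫`, each `z i` would be flipped into the hemisphere
around `e`. Then `⟪x, e⟫` would be the sum of the `|⟪e, z i⟫|`, of order `m / √d`, and the part of
`x` orthogonal to `e` would be a sum of independent symmetric vectors in the unit ball, of order
`√m`. A wrong bit changes either part by at most 2, and wrong bits number fewer than `5 m Δ` with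
probability at least `1 - exp (-m Δ)`, where `Δ` is `deltaCorr g`. The ratio of the two parts is the
tangent of the error angle.

The ingredients are `le_integral_abs_inner` with Hoeffding (main part), `measure_norm_sum_ge_le`
(orthogonal part, dimension-free), `sphereLaw_sgn_ne_le` with Chernoff (wrong bits), and
`cos_le_inner_normalize` (tangent to cosine). `measure_not_success_le` combines them when the error
bound is below `π`. Otherwise only `x ≠ 0` is needed, which holds almost surely for `d ≥ 2`; for `d
= 1` the output is exactly the target.

For the conditional statement, an error bound below `π` makes `Δ` tiny, so `ζ < 1/2` has probability
at least `9/10` by Markov. Conditioning then multiplies the failure probability by at most `10/9`,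
which the slack in the unconditional estimate absorbs. -/

/-- The uniform distribution on the unit sphere, as a measure on the ambient space. -/
noncomputable def sphereLaw (d : ℕ) : Measure (Vec d) := (unifSphere d).map Subtype.val

/-! ### Rotation invariance of the uniform law -/

section Invariance

open scoped Pointwise

variable {d : ℕ}

/-- Surface measure is the volume of the cone over a set, so invariance and null sets can be read
off from Lebesgue measure. -/
lemma sphereLaw_apply {s : Set (Vec d)} (hs : MeasurableSet s) :
    sphereLaw d s = ((volume : Measure (Vec d)).toSphere Set.univ)⁻¹ *
      (Module.finrank ℝ (Vec d) *
        volume (Set.Ioo (0 : ℝ) 1 • (s ∩ Metric.sphere (0 : Vec d) 1))) := by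
  rw [sphereLaw, Measure.map_apply measurable_subtype_coe hs, unifSphere, Measure.smul_apply,
    Measure.toSphere_apply' _ (measurable_subtype_coe hs), Subtype.image_preimage_coe,
    Set.inter_comm, smul_eq_mul]

lemma sphereLaw_map (R : Vec d ≃ₗᵢ[ℝ] Vec d) : (sphereLaw d).map R = sphereLaw d := by
  ext s hs
  have hR : Measurable R := R.continuous.measurable
  rw [Measure.map_apply hR hs, sphereLaw_apply hs, sphereLaw_apply (hR hs)]
  congr 2
  have h : Set.Ioo (0 : ℝ) 1 • (R ⁻¹' s ∩ Metric.sphere (0 : Vec d) 1) =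
      R.toHomeomorph.toMeasurableEquiv ⁻¹'
        (Set.Ioo (0 : ℝ) 1 • (s ∩ Metric.sphere (0 : Vec d) 1)) := by
    ext x
    simp only [Set.mem_smul, Set.mem_preimage, Set.mem_inter_iff, mem_sphere_zero_iff_norm]
    constructor
    · rintro ⟨r, hr, y, ⟨hy, hy'⟩, rfl⟩
      exact ⟨r, hr, R y, ⟨hy, by simpa using hy'⟩, by simp⟩
    · rintro ⟨r, hr, y, ⟨hy, hy'⟩, hxy⟩
      refine ⟨r, hr, R.symm y, ⟨by simpa using hy, by simpa using hy'⟩, ?_⟩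
      apply R.injective
      rw [map_smul, R.apply_symm_apply]
      exact hxy
  rw [h]
  exact MeasurePreserving.measure_preimage_equiv (R.measurePreserving) _

lemma integral_sphereLaw_comp (R : Vec d ≃ₗᵢ[ℝ] Vec d) {F : Type*} [NormedAddCommGroup F]
    [NormedSpace ℝ F] (f : Vec d → F) :
    ∫ y, f (R y) ∂sphereLaw d = ∫ y, f y ∂sphereLaw d := by
  conv_rhs => rw [← sphereLaw_map R]
  exact (R.toHomeomorph.measurableEmbedding.integral_map f).symm

lemma norm_eq_one_ae : ∀ᵐ y ∂sphereLaw d, ‖y‖ = 1 := by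
  rw [sphereLaw, ae_map_iff measurable_subtype_coe.aemeasurable
    (measurableSet_eq_fun measurable_norm measurable_const)]
  exact Filter.Eventually.of_forall fun z => by simp

lemma sphereLaw_singleton (hd : 2 ≤ d) (x : Vec d) : sphereLaw d {x} = 0 := by
  rw [sphereLaw_apply (measurableSet_singleton x)]
  have h : volume (Set.Ioo (0 : ℝ) 1 • ({x} ∩ Metric.sphere (0 : Vec d) 1)) = 0 := by
    refine measure_mono_null (t := (ℝ ∙ x : Submodule ℝ (Vec d))) ?_
      (Measure.addHaar_submodule _ _ ?_)
    · rintro _ ⟨r, -, y, ⟨rfl, -⟩, rfl⟩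
      exact Submodule.smul_mem _ _ (Submodule.mem_span_singleton_self _)
    · intro h
      have h1 := finrank_span_le_card (R := ℝ) ({x} : Set (Vec d))
      rw [h, finrank_top] at h1
      simp at h1
      omega
  rw [h]
  simp

/-- Two reflections suffice: the first takes `u` to `u'`, the second corrects the image of `v`. The
second fixes `u'` because equal inner products make `u'` orthogonal to `R₁ v - v'`. -/
lemma exists_isometry_pair {E : Type*} [NormedAddCommGroup E] [InnerProductSpace ℝ E]
    {u v u' v' : E} (hu : ‖u‖ = ‖u'‖) (hv : ‖v‖ = ‖v'‖) (h : ⟪u, v⟫_ℝ = ⟪u', v'⟫_ℝ) :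
    ∃ R : E ≃ₗᵢ[ℝ] E, R u = u' ∧ R v = v' := by
  set R₁ := Submodule.reflection (ℝ ∙ (u - u'))ᗮ with hR₁
  have h1 : R₁ u = u' := Submodule.reflection_sub hu
  set R₂ := Submodule.reflection (ℝ ∙ (R₁ v - v'))ᗮ with hR₂
  have h2 : R₂ (R₁ v) = v' := Submodule.reflection_sub (by rw [LinearIsometryEquiv.norm_map, hv])
  have h3 : R₂ u' = u' := by
    apply Submodule.reflection_mem_subspace_eq_self
    rw [Submodule.mem_orthogonal_singleton_iff_inner_right, inner_sub_left,
      real_inner_comm, real_inner_comm u' v', ← h, ← h1, LinearIsometryEquiv.inner_map_map, sub_self]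
  exact ⟨R₁.trans R₂, by simp [h1, h3], by simp [h2]⟩

end Invariance

/-! ### Moments of a coordinate of a uniform point -/

section Moments

variable {d : ℕ}

lemma abs_inner_le_one_ae {e : Vec d} (he : ‖e‖ = 1) :
    ∀ᵐ y ∂sphereLaw d, |⟪e, y⟫_ℝ| ≤ 1 := by
  filter_upwards [norm_eq_one_ae] with y hy
  simpa [he, hy] using abs_real_inner_le_norm e y

lemma integrable_inner_pow_mul [IsProbabilityMeasure (sphereLaw d)] {e f : Vec d} (he : ‖e‖ = 1) (hf : ‖f‖ = 1) (k l : ℕ) :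
    Integrable (fun y => ⟪e, y⟫_ℝ ^ k * ⟪f, y⟫_ℝ ^ l) (sphereLaw d) := by
  refine Integrable.of_bound (by fun_prop) 1 ?_
  filter_upwards [abs_inner_le_one_ae he, abs_inner_le_one_ae hf] with y h1 h2
  rw [Real.norm_eq_abs, abs_mul, abs_pow, abs_pow]
  exact mul_le_one₀ (pow_le_one₀ (abs_nonneg _) h1) (by positivity) (pow_le_one₀ (abs_nonneg _) h2)

lemma integrable_inner_pow [IsProbabilityMeasure (sphereLaw d)] {e : Vec d} (he : ‖e‖ = 1) (k : ℕ) :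
    Integrable (fun y => ⟪e, y⟫_ℝ ^ k) (sphereLaw d) := by
  simpa using integrable_inner_pow_mul he he k 0

lemma integral_comp_inner_eq {e f : Vec d} (he : ‖e‖ = 1) (hf : ‖f‖ = 1) (φ : ℝ → ℝ) :
    ∫ y, φ ⟪e, y⟫_ℝ ∂sphereLaw d = ∫ y, φ ⟪f, y⟫_ℝ ∂sphereLaw d := by
  obtain ⟨R, hR, -⟩ := exists_isometry_pair (u := e) (v := e) (u' := f) (v' := f)
    (by rw [he, hf]) (by rw [he, hf]) (by simp [he, hf])
  rw [← integral_sphereLaw_comp R fun y => φ ⟪f, y⟫_ℝ, ← hR]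
  simp only [LinearIsometryEquiv.inner_map_map]

lemma sum_inner_sq_eq_one_ae :
    ∀ᵐ y ∂sphereLaw d, ∑ i : Fin d, ⟪EuclideanSpace.single i (1 : ℝ), y⟫_ℝ ^ 2 = 1 := by
  filter_upwards [norm_eq_one_ae (d := d)] with y hy
  have := EuclideanSpace.real_norm_sq_eq y
  rw [hy] at this
  simpa [EuclideanSpace.inner_single_left] using this.symm

lemma integral_inner_sq [IsProbabilityMeasure (sphereLaw d)] {e : Vec d} (he : ‖e‖ = 1) :
    d * ∫ y, ⟪e, y⟫_ℝ ^ 2 ∂sphereLaw d = 1 := by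
  have h1 : ∫ y, ∑ i : Fin d, ⟪EuclideanSpace.single i (1 : ℝ), y⟫_ℝ ^ 2 ∂sphereLaw d = 1 := by
    rw [integral_congr_ae sum_inner_sq_eq_one_ae]
    simp
  rw [integral_finsetSum _ fun i _ => integrable_inner_pow (by simp) 2] at h1
  rw [← h1, Finset.sum_congr rfl fun i _ => integral_comp_inner_eq (by simp) he (fun x => x ^ 2)]
  simp

/-- Rotating the pair `e`, `f` by 45 degrees leaves fourth moments unchanged; expanding the rotated
fourth powers isolates the mixed moment. -/
lemma integral_inner_sq_mul_sq [IsProbabilityMeasure (sphereLaw d)] {e f : Vec d} (he : ‖e‖ = 1) (hf : ‖f‖ = 1)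
    (hef : ⟪e, f⟫_ℝ = 0) :
    3 * ∫ y, ⟪e, y⟫_ℝ ^ 2 * ⟪f, y⟫_ℝ ^ 2 ∂sphereLaw d = ∫ y, ⟪e, y⟫_ℝ ^ 4 ∂sphereLaw d := by
  have hs : (√2)⁻¹ ^ 2 = (1 / 2 : ℝ) := by rw [inv_pow, Real.sq_sqrt (by norm_num)]; norm_num
  have hp : ‖(√2 : ℝ)⁻¹ • (e + f)‖ = 1 := by
    rw [← sq_eq_sq₀ (norm_nonneg _) zero_le_one, norm_smul, mul_pow, norm_add_sq_real, he, hf, hef,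
      Real.norm_eq_abs, sq_abs, hs]
    norm_num
  have hm : ‖(√2 : ℝ)⁻¹ • (e - f)‖ = 1 := by
    rw [← sq_eq_sq₀ (norm_nonneg _) zero_le_one, norm_smul, mul_pow, norm_sub_sq_real, he, hf, hef,
      Real.norm_eq_abs, sq_abs, hs]
    norm_num
  have h1 := integral_comp_inner_eq hp he (fun x => x ^ 4)
  have h2 := integral_comp_inner_eq hm he (fun x => x ^ 4)
  have h3 := integral_comp_inner_eq hf he (fun x => x ^ 4)
  have h4 : ∫ y, (⟪(√2 : ℝ)⁻¹ • (e + f), y⟫_ℝ ^ 4 + ⟪(√2 : ℝ)⁻¹ • (e - f), y⟫_ℝ ^ 4) ∂sphereLaw d =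
      ∫ y, ((1 / 2) * ⟪e, y⟫_ℝ ^ 4 + (1 / 2) * ⟪f, y⟫_ℝ ^ 4 +
        3 * (⟪e, y⟫_ℝ ^ 2 * ⟪f, y⟫_ℝ ^ 2)) ∂sphereLaw d := by
    congr 1 with y
    simp only [inner_smul_left, inner_add_left, inner_sub_left, mul_pow]
    have : (√2)⁻¹ ^ 4 = (1 / 4 : ℝ) := by
      rw [show (4 : ℕ) = 2 * 2 by norm_num, pow_mul, hs]; norm_num
    simp only [RCLike.conj_to_real, this]
    ring
  rw [integral_add (integrable_inner_pow hp 4) (integrable_inner_pow hm 4),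
    integral_add (f := fun y => 1 / 2 * ⟪e, y⟫_ℝ ^ 4 + 1 / 2 * ⟪f, y⟫_ℝ ^ 4)
      (((integrable_inner_pow he 4).const_mul _).add ((integrable_inner_pow hf 4).const_mul _))
      ((integrable_inner_pow_mul he hf 2 2).const_mul _),
    integral_add ((integrable_inner_pow he 4).const_mul _)
      ((integrable_inner_pow hf 4).const_mul _),
    integral_const_mul, integral_const_mul, integral_const_mul, h1, h2, h3] at h4
  linarith

/-- Integrate the square of `∑ ⟪b i, y⟫ ^ 2 = 1`: the `d` diagonal terms give the fourth moment and
the others a third of it. -/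
lemma integral_inner_pow_four [IsProbabilityMeasure (sphereLaw d)] {e : Vec d} (he : ‖e‖ = 1) :
    d * (d + 2) * ∫ y, ⟪e, y⟫_ℝ ^ 4 ∂sphereLaw d = 3 := by
  set b : Fin d → Vec d := fun i => EuclideanSpace.single i (1 : ℝ) with hb
  have hb1 : ∀ i, ‖b i‖ = 1 := fun i => by simp [hb]
  set a := ∫ y, ⟪e, y⟫_ℝ ^ 4 ∂sphereLaw d with ha
  have h1 : ∫ y, ∑ i, ∑ j, ⟪b i, y⟫_ℝ ^ 2 * ⟪b j, y⟫_ℝ ^ 2 ∂sphereLaw d = 1 := by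
    have : ∀ᵐ y ∂sphereLaw d, ∑ i, ∑ j, ⟪b i, y⟫_ℝ ^ 2 * ⟪b j, y⟫_ℝ ^ 2 = 1 := by
      filter_upwards [sum_inner_sq_eq_one_ae (d := d)] with y hy
      rw [← Finset.sum_mul_sum, hy, one_mul]
    rw [integral_congr_ae this]
    simp
  rw [integral_finsetSum _ fun i _ => integrable_finsetSum _ fun j _ =>
    integrable_inner_pow_mul (hb1 i) (hb1 j) 2 2] at h1
  have h2 : ∀ i j, ∫ y, ⟪b i, y⟫_ℝ ^ 2 * ⟪b j, y⟫_ℝ ^ 2 ∂sphereLaw d =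
      a / 3 + if i = j then 2 * a / 3 else 0 := by
    intro i j
    have h4 : ∫ y, ⟪b i, y⟫_ℝ ^ 4 ∂sphereLaw d = a :=
      integral_comp_inner_eq (hb1 i) he (fun x => x ^ 4)
    split_ifs with hij
    · subst hij
      simp_rw [← pow_add]
      rw [h4]
      ring
    · have := integral_inner_sq_mul_sq (hb1 i) (hb1 j)
        (by simp [hb, EuclideanSpace.inner_single_left, hij])
      rw [h4] at this
      linarith
  simp_rw [integral_finsetSum _ fun j _ => integrable_inner_pow_mul (hb1 _) (hb1 j) 2 2, h2,
    Finset.sum_add_distrib] at h1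
  simp at h1
  linear_combination 3 * h1

lemma integrable_abs_inner [IsProbabilityMeasure (sphereLaw d)] {e : Vec d} (he : ‖e‖ = 1) :
    Integrable (fun y => |⟪e, y⟫_ℝ|) (sphereLaw d) := by
  simpa using (integrable_inner_pow he 1).abs

/-- A lower bound for the first absolute moment of a coordinate, from its second and fourth. -/
lemma le_integral_abs_inner [IsProbabilityMeasure (sphereLaw d)] (hd : 0 < d) {e : Vec d} (he : ‖e‖ = 1) :
    √((d + 2) / 3) / d ≤ ∫ y, |⟪e, y⟫_ℝ| ∂sphereLaw d := by
  have hd' : (0 : ℝ) < d := by exact_mod_cast hd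
  set ν : ℝ := √((d + 2) / 3) with hν
  have hν0 : 0 < ν := Real.sqrt_pos.2 (by positivity)
  have hν2 : ν ^ 2 = (d + 2) / 3 := Real.sq_sqrt (by positivity)
  -- This is `(u - 1) ^ 2 * (u + 2) ≥ 0` at `u = ν * |x|`. The choice of `ν ^ 2` as the ratio of
  -- second to fourth moment optimises the integrated bound.
  have hpt : ∀ x : ℝ, (3 * ν / 2) * x ^ 2 - (ν ^ 3 / 2) * x ^ 4 ≤ |x| := by
    intro x
    have h0 := abs_nonneg x
    rw [← sq_abs x, show x ^ 4 = |x| ^ 4 by rw [pow_abs, abs_of_nonneg (by positivity)]]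
    set u := ν * |x| with hu
    have hu0 : 0 ≤ u := by positivity
    have key : 0 ≤ |x| * ((u - 1) ^ 2 * (u + 2)) := by positivity
    have : |x| * ((u - 1) ^ 2 * (u + 2)) = ν ^ 3 * |x| ^ 4 - 3 * ν * |x| ^ 2 + 2 * |x| := by
      rw [hu]; ring
    linarith
  have h1 := integral_mono (((integrable_inner_pow he 2).const_mul (3 * ν / 2)).sub
    ((integrable_inner_pow he 4).const_mul (ν ^ 3 / 2))) (integrable_abs_inner he)
    (fun y => hpt ⟪e, y⟫_ℝ)
  refine le_trans (le_of_eq ?_) h1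
  have h2 : ∫ y, ⟪e, y⟫_ℝ ^ 2 ∂sphereLaw d = 1 / d := by
    rw [eq_div_iff hd'.ne']; linarith [integral_inner_sq he]
  have h4 : ∫ y, ⟪e, y⟫_ℝ ^ 4 ∂sphereLaw d = 3 / (d * (d + 2)) := by
    rw [eq_div_iff (by positivity)]; linarith [integral_inner_pow_four he]
  simp only [Pi.sub_apply]
  rw [integral_sub ((integrable_inner_pow he 2).const_mul _)
    ((integrable_inner_pow he 4).const_mul _), integral_const_mul, integral_const_mul, h2, h4,
    show ν ^ 3 = ν ^ 2 * ν by ring, hν2]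
  field_simp
  ring

end Moments

/-! ### Probability that two vectors give different signs -/

section Wedge

variable {d : ℕ}

/-- The great circle through `u` in the direction of `h`. -/
noncomputable def circlePoint (u h : Vec d) (t : ℝ) : Vec d := Real.cos t • u + Real.sin t • h

lemma inner_circlePoint {u h : Vec d} (hu : ‖u‖ = 1) (hh : ‖h‖ = 1) (huh : ⟪u, h⟫_ℝ = 0)
    (s t : ℝ) : ⟪circlePoint u h s, circlePoint u h t⟫_ℝ = Real.cos (t - s) := by
  have huh' : ⟪h, u⟫_ℝ = 0 := by rw [real_inner_comm, huh]
  simp only [circlePoint, inner_add_left, inner_add_right, inner_smul_left, inner_smul_right,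
    real_inner_self_eq_norm_sq, hu, hh, huh, huh', Real.cos_sub, RCLike.conj_to_real]
  ring

lemma norm_circlePoint {u h : Vec d} (hu : ‖u‖ = 1) (hh : ‖h‖ = 1) (huh : ⟪u, h⟫_ℝ = 0)
    (t : ℝ) : ‖circlePoint u h t‖ = 1 := by
  have := inner_circlePoint hu hh huh t t
  rw [real_inner_self_eq_norm_sq, sub_self, Real.cos_zero] at this
  exact (pow_eq_one_iff_of_nonneg (norm_nonneg _) two_ne_zero).1 this

lemma exists_circlePoint_eq {u v : Vec d} (hu : ‖u‖ = 1) (hv : ‖v‖ = 1)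
    (hs : 0 < Real.sin (Real.arccos ⟪u, v⟫_ℝ)) :
    ∃ h : Vec d, ‖h‖ = 1 ∧ ⟪u, h⟫_ℝ = 0 ∧ circlePoint u h (Real.arccos ⟪u, v⟫_ℝ) = v := by
  have habs := abs_le.1 (abs_real_inner_le_norm u v)
  rw [hu, hv, one_mul] at habs
  set θ := Real.arccos ⟪u, v⟫_ℝ with hθ
  have hc : Real.cos θ = ⟪u, v⟫_ℝ := Real.cos_arccos habs.1 habs.2
  have hs2 := Real.sin_sq_add_cos_sq θ
  refine ⟨(Real.sin θ)⁻¹ • (v - Real.cos θ • u), ?_, ?_, ?_⟩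
  · have : ‖v - Real.cos θ • u‖ ^ 2 = Real.sin θ ^ 2 := by
      rw [norm_sub_sq_real, norm_smul, inner_smul_right, hu, hv, real_inner_comm, ← hc,
        Real.norm_eq_abs, mul_one, sq_abs]
      linarith
    rw [sq_eq_sq₀ (norm_nonneg _) hs.le] at this
    rw [norm_smul, this, norm_inv, Real.norm_eq_abs, abs_of_pos hs, inv_mul_cancel₀ hs.ne']
  · rw [inner_smul_right, inner_sub_right, inner_smul_right, real_inner_self_eq_norm_sq, hu, hc]
    ring
  · rw [circlePoint, smul_smul, mul_inv_cancel₀ hs.ne', one_smul]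
    abel

/-- The points separated by `u` and `v`, on the positive side of `u`. -/
def wedge (u v : Vec d) : Set (Vec d) := {y | 0 ≤ ⟪u, y⟫_ℝ ∧ ⟪v, y⟫_ℝ < 0}

lemma measurableSet_wedge (u v : Vec d) : MeasurableSet (wedge u v) := by
  have h : ∀ w : Vec d, Measurable fun y : Vec d => ⟪w, y⟫_ℝ := fun w => by fun_prop
  exact (measurableSet_le measurable_const (h u)).inter
    (measurableSet_lt (h v) measurable_const)

lemma sphereLaw_wedge_eq {u v u' v' : Vec d} (hu : ‖u‖ = ‖u'‖) (hv : ‖v‖ = ‖v'‖)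
    (h : ⟪u, v⟫_ℝ = ⟪u', v'⟫_ℝ) :
    (sphereLaw d).real (wedge u' v') = (sphereLaw d).real (wedge u v) := by
  obtain ⟨R, rfl, rfl⟩ := exists_isometry_pair hu hv h
  conv_lhs => rw [← sphereLaw_map R]
  rw [map_measureReal_apply R.continuous.measurable (measurableSet_wedge _ _)]
  simp [wedge]

/-- The point at angle `a + θ` lies in the cone spanned by those at `a` and `b`, so a `y` on the
nonnegative side of both is on its nonnegative side too. -/
lemma disjoint_wedge_circlePoint (u h : Vec d) {θ a b : ℝ} (hθ : 0 < θ) (hθπ : θ < Real.pi)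
    (hab : a + θ ≤ b) (hb : b - a < Real.pi) :
    Disjoint (wedge (circlePoint u h a) (circlePoint u h (a + θ)))
      (wedge (circlePoint u h b) (circlePoint u h (b + θ))) := by
  rw [Set.disjoint_left]
  rintro y ⟨h1, h2⟩ ⟨h3, -⟩
  have key : ⟪circlePoint u h (a + θ), y⟫_ℝ * Real.sin (b - a) =
      ⟪circlePoint u h a, y⟫_ℝ * Real.sin (b - a - θ) + ⟪circlePoint u h b, y⟫_ℝ * Real.sin θ := by
    have hb : b = a + θ + (b - a - θ) := by ring
    generalize b - a - θ = c at hb ⊢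
    subst hb
    rw [show a + θ + c - a = θ + c by ring]
    simp only [circlePoint, inner_add_left, inner_smul_left, RCLike.conj_to_real, Real.cos_add,
      Real.sin_add]
    have hc := Real.sin_sq_add_cos_sq c
    have ht := Real.sin_sq_add_cos_sq θ
    generalize Real.sin c = sc at *
    generalize Real.cos c = cc at *
    generalize Real.sin θ = st at *
    generalize Real.cos θ = ct at *
    linear_combination (⟪u, y⟫_ℝ * Real.cos a + ⟪h, y⟫_ℝ * Real.sin a) * sc * ht
  have h4 : 0 < Real.sin (b - a) := Real.sin_pos_of_pos_of_lt_pi (by linarith) hb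
  have h5 : 0 ≤ Real.sin (b - a - θ) :=
    Real.sin_nonneg_of_nonneg_of_le_pi (by linarith) (by linarith)
  have h6 : 0 < Real.sin θ := Real.sin_pos_of_pos_of_lt_pi hθ hθπ
  have := mul_neg_of_neg_of_pos h2 h4
  rw [key] at this
  have := mul_nonneg h1 h5
  have := mul_nonneg h3 h6.le
  linarith

/-- Packing argument: the rotations of the wedge by multiples of `θ` within a half turn are disjoint
and equally likely, and there are at least `π / θ` of them. Using half a turn instead of a full one
costs a factor of two. -/
lemma sphereLaw_wedge_le [IsProbabilityMeasure (sphereLaw d)] {u v : Vec d} (hu : ‖u‖ = 1)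
    (hv : ‖v‖ = 1) :
    (sphereLaw d).real (wedge u v) ≤ Real.arccos ⟪u, v⟫_ℝ / Real.pi := by
  have hpi := Real.pi_pos
  have habs := abs_le.1 (abs_real_inner_le_norm u v)
  rw [hu, hv, one_mul] at habs
  rcases (Real.arccos_nonneg ⟪u, v⟫_ℝ).eq_or_lt with h0 | h0
  · have h1 : ⟪u, v⟫_ℝ = 1 := le_antisymm habs.2 (Real.arccos_eq_zero.1 h0.symm)
    rw [inner_eq_one_iff_of_norm_eq_one hu hv] at h1
    subst h1
    have : wedge u u = ∅ := by
      ext y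
      simp only [wedge, Set.mem_ofPred_eq, Set.mem_empty_iff_false, iff_false, not_and, not_lt,
        imp_self]
    rw [this, measureReal_empty]
    positivity
  rcases (Real.arccos_le_pi ⟪u, v⟫_ℝ).eq_or_lt with hp | hp
  · rw [hp, div_self hpi.ne']
    exact measureReal_le_one
  obtain ⟨h, hh, huh, hv'⟩ := exists_circlePoint_eq hu hv (Real.sin_pos_of_pos_of_lt_pi h0 hp)
  have hc : Real.cos (Real.arccos ⟪u, v⟫_ℝ) = ⟪u, v⟫_ℝ := Real.cos_arccos habs.1 habs.2
  set θ := Real.arccos ⟪u, v⟫_ℝ with hθ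
  -- Rounding up is allowed because only the starting angles `k * θ` with `k < n` must stay below
  -- `π`.
  set n := ⌈Real.pi / θ⌉₊ with hn
  have hn1 : Real.pi / θ ≤ n := Nat.le_ceil _
  have hn2 : n < Real.pi / θ + 1 := Nat.ceil_lt_add_one (by positivity)
  have hn0 : (0 : ℝ) < n := lt_of_lt_of_le (by positivity) hn1
  let A : ℕ → Set (Vec d) := fun k => wedge (circlePoint u h (k * θ)) (circlePoint u h (k * θ + θ))
  have hA : ∀ k, (sphereLaw d).real (A k) = (sphereLaw d).real (wedge u v) := fun k =>
    sphereLaw_wedge_eq (by rw [norm_circlePoint hu hh huh, hu])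
      (by rw [norm_circlePoint hu hh huh, hv])
      (by rw [inner_circlePoint hu hh huh, add_sub_cancel_left, hc])
  have hlt : ∀ j k : ℕ, k < n → j < k → Disjoint (A j) (A k) := by
    intro j k hk hjk
    have hjk' : (j : ℝ) + 1 ≤ k := by exact_mod_cast hjk
    have hk' : (k : ℝ) + 1 ≤ n := by exact_mod_cast hk
    refine disjoint_wedge_circlePoint u h h0 hp (by nlinarith) ?_
    have h3 : (k : ℝ) < Real.pi / θ := by linarith
    rw [lt_div_iff₀ h0] at h3
    have : 0 ≤ j * θ := by positivity
    linarith
  have hdisj : (Finset.range n : Set ℕ).PairwiseDisjoint A := by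
    intro j hj k hk hjk
    simp only [Finset.coe_range, Set.mem_Iio] at hj hk
    rcases lt_or_gt_of_ne hjk with h | h
    · exact hlt j k hk h
    · exact (hlt k j hj h).symm
  have hsum := measureReal_biUnion_finset (μ := sphereLaw d) hdisj
    (fun k _ => measurableSet_wedge _ _)
  have hle : (sphereLaw d).real (⋃ b ∈ Finset.range n, A b) ≤ 1 := measureReal_le_one
  rw [hsum, Finset.sum_congr rfl fun k _ => hA k, Finset.sum_const, Finset.card_range,
    nsmul_eq_mul] at hle
  calc (sphereLaw d).real (wedge u v) ≤ 1 / n := by rw [le_div_iff₀ hn0]; linarith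
    _ ≤ θ / Real.pi := by
      rw [div_le_div_iff₀ hn0 hpi]
      rw [div_le_iff₀ h0] at hn1
      linarith

lemma sgn_ne_sgn_subset (u v : Vec d) :
    {y : Vec d | sgn ⟪u, y⟫_ℝ ≠ sgn ⟪v, y⟫_ℝ} ⊆ wedge u v ∪ wedge v u := by
  intro y hy
  by_contra hc
  simp only [wedge, Set.mem_union, Set.mem_ofPred_eq, not_or, not_and, not_lt] at hc
  apply hy
  simp only [sgn]
  by_cases h : 0 ≤ ⟪u, y⟫_ℝ
  · rw [if_pos h, if_pos (hc.1 h)]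
  · rw [if_neg h, if_neg fun h' => h (hc.2 h')]

/-- Two unit vectors at angle `θ` put a uniform point on different sides with probability at
most `2 θ / π`. -/
lemma sphereLaw_sgn_ne_le [IsProbabilityMeasure (sphereLaw d)] {u v : Vec d} (hu : ‖u‖ = 1)
    (hv : ‖v‖ = 1) :
    (sphereLaw d).real {y | sgn ⟪u, y⟫_ℝ ≠ sgn ⟪v, y⟫_ℝ} ≤
      2 * (Real.arccos ⟪u, v⟫_ℝ / Real.pi) := by
  have h1 := sphereLaw_wedge_le hu hv
  have h2 := sphereLaw_wedge_le hv hu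
  rw [real_inner_comm] at h2
  have h3 := measureReal_mono (μ := sphereLaw d) (sgn_ne_sgn_subset u v)
  have h4 := measureReal_union_le (μ := sphereLaw d) (wedge u v) (wedge v u)
  linarith

end Wedge

/-! ### Dimension-free Hoeffding inequality for symmetric vectors -/

section Symmetric

lemma norm_sum_le_card_ae {E Ω ι : Type*} [NormedAddCommGroup E] [MeasurableSpace Ω]
    {P : Measure Ω} {W : ι → Ω → E} (hb : ∀ i, ∀ᵐ ω ∂P, ‖W i ω‖ ≤ 1) (s : Finset ι) :
    ∀ᵐ ω ∂P, ‖∑ i ∈ s, W i ω‖ ≤ s.card := by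
  have : ∀ᵐ ω ∂P, ∀ i ∈ s, ‖W i ω‖ ≤ 1 := (Finset.eventually_all s).2 fun i _ => hb i
  filter_upwards [this] with ω h
  calc ‖∑ i ∈ s, W i ω‖ ≤ ∑ i ∈ s, ‖W i ω‖ := norm_sum_le _ _
    _ ≤ ∑ _i ∈ s, 1 := Finset.sum_le_sum h
    _ = s.card := by simp

lemma integrable_cosh_norm {E Ω : Type*} [NormedAddCommGroup E] [MeasurableSpace E]
    [BorelSpace E] [MeasurableSpace Ω] {P : Measure Ω} [IsFiniteMeasure P] {X : Ω → E} (hX : AEMeasurable X P) {c : ℝ}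
    (hc : ∀ᵐ ω ∂P, ‖X ω‖ ≤ c) (t : ℝ) : Integrable (fun ω => Real.cosh (t * ‖X ω‖)) P := by
  refine Integrable.of_bound (Real.continuous_cosh.measurable.comp_aemeasurable
    (hX.norm.const_mul t)).aestronglyMeasurable (Real.cosh (t * c)) ?_
  filter_upwards [hc] with ω h
  rw [Real.norm_eq_abs, abs_of_pos (Real.cosh_pos _), Real.cosh_le_cosh, abs_mul, abs_mul,
    abs_norm]
  exact mul_le_mul_of_nonneg_left (h.trans (le_abs_self c)) (abs_nonneg t)

/-- Both `p + q` and `p - q` are convex combinations of `p ± r`, with the two weights interchanged.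
-/
lemma convexOn_add_sub_le {f : ℝ → ℝ} (hf : ConvexOn ℝ (Set.Ici 0) f) {p q r : ℝ}
    (hqr : |q| ≤ r) (hrp : r ≤ p) : f (p + q) + f (p - q) ≤ f (p + r) + f (p - r) := by
  have hr : 0 ≤ r := (abs_nonneg q).trans hqr
  obtain ⟨h1, h2⟩ := abs_le.1 hqr
  rcases hr.eq_or_lt with h0 | h0
  · obtain rfl : q = 0 := by linarith
    rw [← h0]
  have ha : 0 ≤ (r + q) / (2 * r) := div_nonneg (by linarith) (by linarith)
  have hb : 0 ≤ (r - q) / (2 * r) := div_nonneg (by linarith) (by linarith)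
  have hab : (r + q) / (2 * r) + (r - q) / (2 * r) = 1 := by field_simp; ring
  have hx : p + r ∈ Set.Ici (0 : ℝ) := by simp only [Set.mem_Ici]; linarith
  have hy : p - r ∈ Set.Ici (0 : ℝ) := by simp only [Set.mem_Ici]; linarith
  have e1 := hf.2 hx hy ha hb hab
  have e2 := hf.2 hx hy hb ha (by rw [add_comm, hab])
  simp only [smul_eq_mul] at e1 e2
  rw [show (r + q) / (2 * r) * (p + r) + (r - q) / (2 * r) * (p - r) = p + q by
    field_simp; ring] at e1
  rw [show (r - q) / (2 * r) * (p + r) + (r + q) / (2 * r) * (p - r) = p - q by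
    field_simp; ring] at e2
  have : f (p + r) + f (p - r) = ((r + q) / (2 * r) + (r - q) / (2 * r)) * (f (p + r) + f (p - r)) := by
    rw [hab, one_mul]
  linarith

variable {E : Type*} [NormedAddCommGroup E] [InnerProductSpace ℝ E]

/-- The right side is `cosh (‖x‖ + ‖w‖) + cosh (‖x‖ - ‖w‖)`. The series of `cosh` involves only
powers of squared norms, so Cauchy–Schwarz and convexity of `y ^ k` compare the two sides term by
term. -/
lemma cosh_norm_add_add_cosh_norm_sub_le (x w : E) :
    Real.cosh ‖x + w‖ + Real.cosh ‖x - w‖ ≤ 2 * (Real.cosh ‖x‖ * Real.cosh ‖w‖) := by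
  have e : 2 * (Real.cosh ‖x‖ * Real.cosh ‖w‖) =
      Real.cosh (‖x‖ + ‖w‖) + Real.cosh (‖x‖ - ‖w‖) := by
    rw [Real.cosh_add, Real.cosh_sub]; ring
  rw [e]
  refine hasSum_le (fun k => ?_)
    ((Real.hasSum_cosh ‖x + w‖).add (Real.hasSum_cosh ‖x - w‖))
    ((Real.hasSum_cosh (‖x‖ + ‖w‖)).add (Real.hasSum_cosh (‖x‖ - ‖w‖)))
  rw [← add_div, ← add_div]
  refine div_le_div_of_nonneg_right ?_ (by positivity)
  have h1 : ‖x + w‖ ^ 2 = (‖x‖ ^ 2 + ‖w‖ ^ 2) + 2 * ⟪x, w⟫_ℝ := by rw [norm_add_sq_real]; ring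
  have h2 : ‖x - w‖ ^ 2 = (‖x‖ ^ 2 + ‖w‖ ^ 2) - 2 * ⟪x, w⟫_ℝ := by rw [norm_sub_sq_real]; ring
  have h3 : (‖x‖ + ‖w‖) ^ 2 = (‖x‖ ^ 2 + ‖w‖ ^ 2) + 2 * (‖x‖ * ‖w‖) := by ring
  have h4 : (‖x‖ - ‖w‖) ^ 2 = (‖x‖ ^ 2 + ‖w‖ ^ 2) - 2 * (‖x‖ * ‖w‖) := by ring
  rw [pow_mul, pow_mul, pow_mul, pow_mul, h1, h2, h3, h4]
  refine convexOn_add_sub_le (f := fun y => y ^ k) (convexOn_pow k) ?_ ?_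
  · rw [abs_mul, abs_two]
    linarith [abs_real_inner_le_norm x w]
  · nlinarith [sq_nonneg (‖x‖ - ‖w‖)]

variable [MeasurableSpace E] [BorelSpace E] [SecondCountableTopology E]
  {Ω : Type*} [MeasurableSpace Ω] {P : Measure Ω} {ι : Type*}

/-- For independent symmetric vectors in the unit ball, the hyperbolic cosine of the norm of the sum
has at most the expectation it has for a sum of signs. -/
lemma integral_cosh_norm_sum_le {W : ι → Ω → E} (hW : iIndepFun W P)
    (hm : ∀ i, AEMeasurable (W i) P) (hsymm : ∀ i, P.map (fun ω => -W i ω) = P.map (W i))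
    (hb : ∀ i, ∀ᵐ ω ∂P, ‖W i ω‖ ≤ 1) (t : ℝ) (s : Finset ι) :
    ∫ ω, Real.cosh (t * ‖∑ i ∈ s, W i ω‖) ∂P ≤ Real.cosh t ^ s.card := by
  have : IsProbabilityMeasure P := hW.isProbabilityMeasure
  classical
  induction s using Finset.induction_on with
  | empty => simp
  | insert i s his ih =>
    set S : Ω → E := fun ω => ∑ j ∈ s, W j ω with hS
    have hSm : AEMeasurable S P := Finset.aemeasurable_fun_sum s fun j _ => hm j
    have hind : IndepFun S (W i) P := by
      have := hW.indepFun_finsetSum_of_notMem₀ hm his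
      convert this using 1
      ext ω
      simp [hS]
    have hind' : IndepFun S (fun ω => -W i ω) P := hind.comp measurable_id measurable_neg
    -- Independence and symmetry allow the sign of the new summand to be flipped, so twice the
    -- expectation is bounded by the two-sided `cosh` inequality.
    have hlaw : P.map (fun ω => (S ω, -W i ω)) = P.map (fun ω => (S ω, W i ω)) := by
      have hneg : AEMeasurable (fun ω => -W i ω) P := (hm i).neg
      rw [(indepFun_iff_map_prod_eq_prod_map_map hSm hneg).1 hind',
        (indepFun_iff_map_prod_eq_prod_map_map hSm (hm i)).1 hind, hsymm i]
    have hF : Measurable fun p : E × E => Real.cosh (t * ‖p.1 + p.2‖) := by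
      refine Real.continuous_cosh.measurable.comp ?_
      fun_prop
    have heq : ∫ ω, Real.cosh (t * ‖S ω - W i ω‖) ∂P = ∫ ω, Real.cosh (t * ‖S ω + W i ω‖) ∂P := by
      have e1 := integral_map (hSm.prodMk (hm i)) (hF.aestronglyMeasurable (μ := _))
      have e2 := integral_map (hSm.prodMk (hm i).neg) (hF.aestronglyMeasurable (μ := _))
      simp only [Pi.neg_apply, ← sub_eq_add_neg] at e2
      rw [← e1, ← hlaw]
      exact e2.symm
    have hSb := norm_sum_le_card_ae hb s
    have hadd : ∀ᵐ ω ∂P, ‖S ω + W i ω‖ ≤ s.card + 1 := by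
      filter_upwards [hSb, hb i] with ω h1 h2
      exact (norm_add_le _ _).trans (add_le_add h1 h2)
    have hsub : ∀ᵐ ω ∂P, ‖S ω - W i ω‖ ≤ s.card + 1 := by
      filter_upwards [hSb, hb i] with ω h1 h2
      exact (norm_sub_le _ _).trans (add_le_add h1 h2)
    have i1 := integrable_cosh_norm (X := fun ω => S ω + W i ω) (hSm.add (hm i)) hadd t
    have i2 := integrable_cosh_norm (X := fun ω => S ω - W i ω) (hSm.sub (hm i)) hsub t
    have i3 := (integrable_cosh_norm hSm hSb t).const_mul (2 * Real.cosh t)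
    have hle : ∫ ω, (Real.cosh (t * ‖S ω + W i ω‖) + Real.cosh (t * ‖S ω - W i ω‖)) ∂P ≤
        ∫ ω, 2 * Real.cosh t * Real.cosh (t * ‖S ω‖) ∂P := by
      refine integral_mono_ae (i1.add i2) i3 ?_
      filter_upwards [hb i] with ω h
      have key := cosh_norm_add_add_cosh_norm_sub_le (t • S ω) (t • W i ω)
      rw [← smul_add, ← smul_sub, norm_smul, norm_smul, norm_smul, norm_smul, Real.norm_eq_abs,
        ← abs_norm (S ω), ← abs_norm (W i ω), ← abs_norm (S ω + W i ω), ← abs_norm (S ω - W i ω),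
        ← abs_mul, ← abs_mul, ← abs_mul, ← abs_mul, Real.cosh_abs, Real.cosh_abs, Real.cosh_abs,
        Real.cosh_abs] at key
      refine key.trans ?_
      have : Real.cosh (t * ‖W i ω‖) ≤ Real.cosh t := by
        rw [Real.cosh_le_cosh, abs_mul, abs_norm]
        exact mul_le_of_le_one_right (abs_nonneg t) h
      nlinarith [Real.cosh_pos (t * ‖S ω‖)]
    rw [integral_add i1 i2, heq, integral_const_mul] at hle
    simp_rw [Finset.sum_insert his, Finset.card_insert_of_notMem his, pow_succ]
    have hcm : ∫ ω, Real.cosh (t * ‖W i ω + ∑ j ∈ s, W j ω‖) ∂P =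
        ∫ ω, Real.cosh (t * ‖S ω + W i ω‖) ∂P := by simp_rw [hS, add_comm]
    rw [hcm]
    nlinarith [Real.cosh_pos t]

/-- A dimension-free Hoeffding inequality for independent symmetric vectors in the unit ball. -/
lemma measure_norm_sum_ge_le [Fintype ι] [Nonempty ι] {W : ι → Ω → E} (hW : iIndepFun W P)
    (hm : ∀ i, AEMeasurable (W i) P) (hsymm : ∀ i, P.map (fun ω => -W i ω) = P.map (W i))
    (hb : ∀ i, ∀ᵐ ω ∂P, ‖W i ω‖ ≤ 1) {r : ℝ} (hr : 0 ≤ r) :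
    P.real {ω | r ≤ ‖∑ i, W i ω‖} ≤ 2 * Real.exp (-(r ^ 2 / (2 * Fintype.card ι))) := by
  have : IsProbabilityMeasure P := hW.isProbabilityMeasure
  have hn : (0 : ℝ) < Fintype.card ι := by exact_mod_cast Fintype.card_pos
  set n : ℝ := (Fintype.card ι : ℝ) with hn_def
  -- The minimiser of `n * t ^ 2 / 2 - t * r`.
  set t := r / n with ht
  have ht0 : 0 ≤ t := by positivity
  have h1 := integral_cosh_norm_sum_le hW hm hsymm hb t Finset.univ
  have hint := integrable_cosh_norm (Finset.aemeasurable_fun_sum Finset.univ fun j _ => hm j)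
    (norm_sum_le_card_ae hb Finset.univ) t
  have h2 := mul_meas_ge_le_integral_of_nonneg (μ := P)
    (ae_of_all _ fun ω => (Real.cosh_pos (t * ‖∑ i, W i ω‖)).le) hint (Real.cosh (t * r))
  have h3 : P.real {ω | r ≤ ‖∑ i, W i ω‖} ≤
      P.real {ω | Real.cosh (t * r) ≤ Real.cosh (t * ‖∑ i, W i ω‖)} := by
    refine measureReal_mono fun ω hω => ?_
    simp only [Set.mem_ofPred_eq] at hω ⊢
    rw [Real.cosh_le_cosh, abs_of_nonneg (by positivity), abs_of_nonneg (by positivity)]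
    exact mul_le_mul_of_nonneg_left hω ht0
  have h4 : Real.cosh t ^ (Finset.univ : Finset ι).card ≤ Real.exp (n * (t ^ 2 / 2)) := by
    rw [Finset.card_univ, hn_def, Real.exp_nat_mul]
    exact pow_le_pow_left₀ (Real.cosh_pos _).le (Real.cosh_le_exp_half_sq t) _
  have h5 : Real.exp (t * r) / 2 ≤ Real.cosh (t * r) := by
    rw [Real.cosh_eq]
    linarith [Real.exp_pos (-(t * r))]
  set p := P.real {ω | r ≤ ‖∑ i, W i ω‖}
  have hp0 : 0 ≤ p := measureReal_nonneg
  have h6 : Real.exp (t * r) / 2 * p ≤ Real.exp (n * (t ^ 2 / 2)) := by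
    calc Real.exp (t * r) / 2 * p ≤ Real.cosh (t * r) * p := mul_le_mul_of_nonneg_right h5 hp0
      _ ≤ _ := (mul_le_mul_of_nonneg_left h3 (Real.cosh_pos _).le).trans (h2.trans (h1.trans h4))
  have h7 : -(r ^ 2 / (2 * n)) = n * (t ^ 2 / 2) - t * r := by
    rw [ht]; field_simp; ring
  rw [h7, Real.exp_sub, ← mul_div_assoc, le_div_iff₀ (Real.exp_pos _)]
  linarith

end Symmetric

/-! ### Chernoff, Markov and Hoeffding bounds for scalar sums -/

section Concentration

variable {Ω : Type*} [MeasurableSpace Ω] {P : Measure Ω} {ι : Type*}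

/-- With mean `p`, the value is `1 + (exp 1 - 1) * p ≤ 1 + 2 * p ≤ exp (2 * p)`. -/
lemma mgf_one_le_of_zero_or_one [IsProbabilityMeasure P] {X : Ω → ℝ} (hX : AEMeasurable X P)
    (h01 : ∀ ω, X ω = 0 ∨ X ω = 1) : mgf X P 1 ≤ Real.exp (2 * ∫ ω, X ω ∂P) := by
  have hint : Integrable X P := by
    refine Integrable.of_bound hX.aestronglyMeasurable 1 (ae_of_all _ fun ω => ?_)
    rcases h01 ω with h | h <;> simp [h]
  have h0 : 0 ≤ ∫ ω, X ω ∂P := integral_nonneg fun ω => by rcases h01 ω with h | h <;> simp [h]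
  have h1 : ∀ ω, Real.exp (1 * X ω) = 1 + (Real.exp 1 - 1) * X ω := by
    intro ω
    rcases h01 ω with h | h <;> simp [h]
  rw [mgf]
  simp_rw [h1]
  rw [integral_add (integrable_const _) (hint.const_mul _), integral_const_mul]
  simp only [integral_const, probReal_univ, one_smul]
  have h2 := Real.add_one_le_exp (2 * ∫ ω, X ω ∂P)
  have h3 := Real.exp_one_lt_d9
  nlinarith

/-- A Chernoff bound for sums of independent indicators. -/
lemma measure_sum_indicator_ge_le [Fintype ι] {X : ι → Ω → ℝ} (hX : iIndepFun X P)
    (hm : ∀ i, AEMeasurable (X i) P) (h01 : ∀ i ω, X i ω = 0 ∨ X i ω = 1) {p : ι → ℝ}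
    (hp : ∀ i, ∫ ω, X i ω ∂P ≤ 2 * p i) :
    P.real {ω | 5 * ∑ i, p i ≤ ∑ i, X i ω} ≤ Real.exp (-∑ i, p i) := by
  have : IsProbabilityMeasure P := hX.isProbabilityMeasure
  have hsum : ∀ ω, (∑ i, X i) ω = ∑ i, X i ω := fun ω => by simp
  have hsm : AEMeasurable (∑ i, X i) P := Finset.aemeasurable_sum _ fun i _ => hm i
  have hint : Integrable (fun ω => Real.exp (1 * (∑ i, X i) ω)) P := by
    refine Integrable.of_bound (hsm.const_mul 1).exp.aestronglyMeasurable
      (Real.exp (Fintype.card ι)) (ae_of_all _ fun ω => ?_)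
    rw [Real.norm_eq_abs, Real.abs_exp, one_mul, hsum]
    refine Real.exp_le_exp.2 ?_
    calc ∑ i, X i ω ≤ ∑ _i : ι, (1 : ℝ) :=
          Finset.sum_le_sum fun i _ => by rcases h01 i ω with h | h <;> simp [h]
      _ = Fintype.card ι := by simp
  have h1 := measure_ge_le_exp_mul_mgf (5 * ∑ i, p i) zero_le_one hint
  rw [hX.mgf_sum₀ hm] at h1
  simp only [hsum] at h1
  refine h1.trans ?_
  -- The means are at most `2 * p i`, hence the factor 4; the threshold 5 leaves exponent `-∑ p i`.
  have h2 : ∏ i, mgf (X i) P 1 ≤ Real.exp (4 * ∑ i, p i) := by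
    rw [Finset.mul_sum, Real.exp_sum]
    refine Finset.prod_le_prod (fun i _ => mgf_nonneg) fun i _ => ?_
    refine (mgf_one_le_of_zero_or_one (hm i) (h01 i)).trans (Real.exp_le_exp.2 ?_)
    linarith [hp i]
  calc Real.exp (-1 * (5 * ∑ i, p i)) * ∏ i, mgf (X i) P 1
      ≤ Real.exp (-1 * (5 * ∑ i, p i)) * Real.exp (4 * ∑ i, p i) :=
        mul_le_mul_of_nonneg_left h2 (Real.exp_pos _).le
    _ = Real.exp (-∑ i, p i) := by rw [← Real.exp_add]; congr 1; ring

lemma measure_sum_indicator_ge_le_div [IsProbabilityMeasure P] [Fintype ι] {X : ι → Ω → ℝ}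
    (hm : ∀ i, AEMeasurable (X i) P) (h01 : ∀ i ω, X i ω = 0 ∨ X i ω = 1) {p : ι → ℝ}
    (hp : ∀ i, ∫ ω, X i ω ∂P ≤ 2 * p i) {r : ℝ} (hr : 0 < r) :
    P.real {ω | r ≤ ∑ i, X i ω} ≤ 2 * (∑ i, p i) / r := by
  have hint : ∀ i, Integrable (X i) P := fun i => by
    refine Integrable.of_bound (hm i).aestronglyMeasurable 1 (ae_of_all _ fun ω => ?_)
    rcases h01 i ω with h | h <;> simp [h]
  have h1 := mul_meas_ge_le_integral_of_nonneg (μ := P) (f := fun ω => ∑ i, X i ω)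
    (ae_of_all _ fun ω => Finset.sum_nonneg fun i _ => by rcases h01 i ω with h | h <;> simp [h])
    (integrable_finsetSum _ fun i _ => hint i) r
  rw [integral_finsetSum _ fun i _ => hint i] at h1
  have h2 : ∑ i, ∫ ω, X i ω ∂P ≤ 2 * ∑ i, p i := by
    rw [Finset.mul_sum]
    exact Finset.sum_le_sum fun i _ => hp i
  rw [le_div_iff₀ hr]
  linarith

/-- Hoeffding's inequality for the lower tail of a sum of variables with values in `[0, 1]`. -/
lemma measure_sum_le_le [Fintype ι] [Nonempty ι] {X : ι → Ω → ℝ} (hX : iIndepFun X P)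
    (hm : ∀ i, AEMeasurable (X i) P) (hb : ∀ i, ∀ᵐ ω ∂P, X i ω ∈ Set.Icc (0 : ℝ) 1) {κ x : ℝ}
    (hκ : ∀ i, κ ≤ ∫ ω, X i ω ∂P) (hx : 0 ≤ x) :
    P.real {ω | ∑ i, X i ω ≤ Fintype.card ι * (κ - x)} ≤
      Real.exp (-(2 * Fintype.card ι * x ^ 2)) := by
  have : IsProbabilityMeasure P := hX.isProbabilityMeasure
  have hn : (0 : ℝ) < Fintype.card ι := by exact_mod_cast Fintype.card_pos
  have hind : iIndepFun (fun i ω => -(X i ω - ∫ ω', X i ω' ∂P)) P :=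
    hX.comp (fun i t => -(t - ∫ ω', X i ω' ∂P)) fun i => by fun_prop
  have h1 := HasSubgaussianMGF.measure_sum_ge_le_of_iIndepFun hind (s := Finset.univ)
    (fun i _ => (hasSubgaussianMGF_of_mem_Icc (hm i) (hb i)).neg)
    (ε := Fintype.card ι * x) (by positivity)
  have h2 : {ω | ∑ i, X i ω ≤ Fintype.card ι * (κ - x)} ⊆
      {ω | Fintype.card ι * x ≤ ∑ i, -(X i ω - ∫ ω', X i ω' ∂P)} := by
    intro ω hω
    simp only [Set.mem_ofPred_eq] at hω ⊢
    have h3 : ∑ _i : ι, κ ≤ ∑ i, ∫ ω', X i ω' ∂P := Finset.sum_le_sum fun i _ => hκ i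
    simp only [Finset.sum_const, Finset.card_univ, nsmul_eq_mul] at h3
    rw [Finset.sum_neg_distrib, Finset.sum_sub_distrib]
    linarith
  refine (measureReal_mono h2).trans (h1.trans (le_of_eq ?_))
  congr 1
  simp
  field_simp

end Concentration

/-! ### Folding the sphere onto a hemisphere -/

section Fold

variable {d : ℕ}

lemma measurable_sgn : Measurable sgn :=
  Measurable.ite measurableSet_Ici measurable_const measurable_const

lemma sgn_eq_or (x : ℝ) : sgn x = 1 ∨ sgn x = -1 := by
  unfold sgn
  split_ifs <;> simp

lemma abs_sgn (x : ℝ) : |sgn x| = 1 := by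
  rcases sgn_eq_or x with h | h <;> simp [h]

lemma sgn_mul_self (x : ℝ) : sgn x * x = |x| := by
  unfold sgn
  split_ifs with h
  · rw [one_mul, abs_of_nonneg h]
  · rw [abs_of_neg (not_le.1 h), neg_one_mul]

/-- The component orthogonal to `e` of the representative `± y` in the hemisphere around `e`. -/
noncomputable def foldPerp (e y : Vec d) : Vec d := sgn ⟪e, y⟫_ℝ • (y - ⟪e, y⟫_ℝ • e)

lemma measurable_foldPerp (e : Vec d) : Measurable (foldPerp e) :=
  (measurable_sgn.comp (by fun_prop)).smul (by fun_prop)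

lemma norm_sub_inner_smul_le {e y : Vec d} (he : ‖e‖ = 1) (hy : ‖y‖ = 1) :
    ‖y - ⟪e, y⟫_ℝ • e‖ ≤ 1 := by
  rw [← sq_le_one_iff₀ (norm_nonneg _), norm_sub_sq_real, norm_smul, inner_smul_right,
    real_inner_comm, he, hy, Real.norm_eq_abs, mul_one, sq_abs]
  nlinarith [sq_nonneg ⟪e, y⟫_ℝ]

lemma norm_foldPerp_le {e y : Vec d} (he : ‖e‖ = 1) (hy : ‖y‖ = 1) : ‖foldPerp e y‖ ≤ 1 := by
  rw [foldPerp, norm_smul, Real.norm_eq_abs, abs_sgn, one_mul]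
  exact norm_sub_inner_smul_le he hy

/-- Reflection in the line through `e` preserves the law and `⟪e, y⟫`, and negates the orthogonal
component. This is the symmetry needed for the vector Hoeffding bound. -/
lemma sphereLaw_map_neg_foldPerp {e : Vec d} (he : ‖e‖ = 1) :
    (sphereLaw d).map (fun y => -foldPerp e y) = (sphereLaw d).map (foldPerp e) := by
  set R := Submodule.reflection (ℝ ∙ e) with hR
  have hRe : R e = e :=
    Submodule.reflection_mem_subspace_eq_self (Submodule.mem_span_singleton_self e)
  have hin : ∀ y, ⟪e, R y⟫_ℝ = ⟪e, y⟫_ℝ := fun y => by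
    conv_lhs => rw [← hRe]
    rw [LinearIsometryEquiv.inner_map_map]
  have hfold : ∀ y, foldPerp e (R y) = -foldPerp e y := by
    intro y
    have h : R (y - ⟪e, y⟫_ℝ • e) = -(y - ⟪e, y⟫_ℝ • e) := by
      apply Submodule.reflection_mem_subspace_orthogonalComplement_eq_neg
      rw [Submodule.mem_orthogonal_singleton_iff_inner_right, inner_sub_right, inner_smul_right,
        real_inner_self_eq_norm_sq, he]
      ring
    rw [map_sub, map_smul, hRe] at h
    rw [foldPerp, foldPerp, hin, h, smul_neg]
  have hR' : Measurable R := R.continuous.measurable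
  conv_rhs => rw [← sphereLaw_map R, Measure.map_map (measurable_foldPerp e) hR']
  congr 1
  ext1 y
  exact (hfold y).symm

end Fold

/-! ### Bounds for independent uniform points -/

section Vectors

variable {d : ℕ} {Ω : Type*} [MeasurableSpace Ω] {P : Measure Ω} {ι : Type*} [Fintype ι]
  {y : ι → Ω → Vec d}

lemma measure_norm_sum_foldPerp_ge_le [Nonempty ι] (hy : ∀ i, HasLaw (y i) (sphereLaw d) P)
    (hi : iIndepFun y P) {e : Vec d} (he : ‖e‖ = 1) {r : ℝ} (hr : 0 ≤ r) :
    P.real {ω | r ≤ ‖∑ i, foldPerp e (y i ω)‖} ≤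
      2 * Real.exp (-(r ^ 2 / (2 * Fintype.card ι))) := by
  have hmf := measurable_foldPerp e
  refine measure_norm_sum_ge_le (W := fun i ω => foldPerp e (y i ω))
    (hi.comp (fun _ => foldPerp e) fun _ => hmf)
    (fun i => hmf.comp_aemeasurable (hy i).aemeasurable) (fun i => ?_) (fun i => ?_) hr
  · have h1 := AEMeasurable.map_map_of_aemeasurable (g := fun y => -foldPerp e y)
      hmf.neg.aemeasurable (hy i).aemeasurable
    have h2 := AEMeasurable.map_map_of_aemeasurable (g := foldPerp e)
      hmf.aemeasurable (hy i).aemeasurable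
    rw [(hy i).map_eq] at h1 h2
    exact h1.symm.trans ((sphereLaw_map_neg_foldPerp he).trans h2)
  · have h := norm_eq_one_ae (d := d)
    rw [← (hy i).map_eq] at h
    filter_upwards [ae_of_ae_map (hy i).aemeasurable h] with ω hω
    exact norm_foldPerp_le he hω

lemma measure_sum_abs_inner_le_le [Nonempty ι] (hd : 0 < d)
    (hy : ∀ i, HasLaw (y i) (sphereLaw d) P)
    (hi : iIndepFun y P) {e : Vec d} (he : ‖e‖ = 1) {x : ℝ} (hx : 0 ≤ x) :
    P.real {ω | ∑ i, |⟪e, y i ω⟫_ℝ| ≤ Fintype.card ι * (√((d + 2) / 3) / d - x)} ≤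
      Real.exp (-(2 * Fintype.card ι * x ^ 2)) := by
  have : IsProbabilityMeasure P := hi.isProbabilityMeasure
  have hmeas : Measurable fun v : Vec d => |⟪e, v⟫_ℝ| := by fun_prop
  refine measure_sum_le_le (hi.comp (fun _ v => |⟪e, v⟫_ℝ|) fun _ => hmeas)
    (fun i => hmeas.comp_aemeasurable (hy i).aemeasurable) (fun i => ?_) (fun i => ?_) hx
  · have h := abs_inner_le_one_ae he
    rw [← (hy i).map_eq] at h
    filter_upwards [ae_of_ae_map (hy i).aemeasurable h] with ω hω
    exact ⟨abs_nonneg _, hω⟩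
  · have : IsProbabilityMeasure (sphereLaw d) := (hy i).isProbabilityMeasure_iff.1 ‹_›
    have h := le_integral_abs_inner hd he
    rw [← (hy i).map_eq, integral_map (hy i).aemeasurable hmeas.aestronglyMeasurable] at h
    exact h

open Classical in
/-- The indicator of `y` lying on different sides of `u` and `v`. -/
noncomputable def mismatch (u v y : Vec d) : ℝ := if sgn ⟪u, y⟫_ℝ ≠ sgn ⟪v, y⟫_ℝ then 1 else 0

lemma mismatch_eq_or (u v y : Vec d) : mismatch u v y = 0 ∨ mismatch u v y = 1 := by
  unfold mismatch
  split_ifs <;> simp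

lemma measurableSet_sgn_ne (u v : Vec d) :
    MeasurableSet {y : Vec d | sgn ⟪u, y⟫_ℝ ≠ sgn ⟪v, y⟫_ℝ} :=
  (measurableSet_eq_fun (measurable_sgn.comp (by fun_prop))
    (measurable_sgn.comp (by fun_prop))).compl

lemma measurable_mismatch (u v : Vec d) : Measurable (mismatch u v) :=
  Measurable.ite (measurableSet_sgn_ne u v) measurable_const measurable_const

lemma integral_mismatch_le {X : Ω → Vec d} [IsProbabilityMeasure P]
    (hX : HasLaw X (sphereLaw d) P) {u v : Vec d} (hu : ‖u‖ = 1) (hv : ‖v‖ = 1) :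
    ∫ ω, mismatch u v (X ω) ∂P ≤ 2 * (Real.arccos ⟪u, v⟫_ℝ / Real.pi) := by
  have : IsProbabilityMeasure (sphereLaw d) := hX.isProbabilityMeasure_iff.1 ‹_›
  rw [← integral_map hX.aemeasurable (measurable_mismatch u v).aestronglyMeasurable, hX.map_eq]
  refine le_trans (le_of_eq ?_) (sphereLaw_sgn_ne_le hu hv)
  rw [← integral_indicator_one (measurableSet_sgn_ne u v)]
  congr 1 with y
  simp [mismatch, Set.indicator_apply]

lemma measure_sum_mismatch_ge_le (hy : ∀ i, HasLaw (y i) (sphereLaw d) P) (hi : iIndepFun y P)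
    {g : ι → Vec d} (hg : ∀ i, ‖g i‖ = 1) {e : Vec d} (he : ‖e‖ = 1) :
    P.real {ω | 5 * ∑ i, Real.arccos ⟪g i, e⟫_ℝ / Real.pi ≤ ∑ i, mismatch (g i) e (y i ω)} ≤
      Real.exp (-∑ i, Real.arccos ⟪g i, e⟫_ℝ / Real.pi) := by
  have : IsProbabilityMeasure P := hi.isProbabilityMeasure
  exact measure_sum_indicator_ge_le
    (hi.comp (fun i => mismatch (g i) e) fun i => measurable_mismatch _ _)
    (fun i => (measurable_mismatch _ _).comp_aemeasurable (hy i).aemeasurable)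
    (fun _ _ => mismatch_eq_or _ _ _) fun i => integral_mismatch_le (hy i) (hg i) he

lemma measure_sum_mismatch_ge_le_div [IsProbabilityMeasure P]
    (hy : ∀ i, HasLaw (y i) (sphereLaw d) P)
    {g : ι → Vec d} (hg : ∀ i, ‖g i‖ = 1) {e : Vec d} (he : ‖e‖ = 1) {r : ℝ} (hr : 0 < r) :
    P.real {ω | r ≤ ∑ i, mismatch (g i) e (y i ω)} ≤
      2 * (∑ i, Real.arccos ⟪g i, e⟫_ℝ / Real.pi) / r :=
  measure_sum_indicator_ge_le_div
    (fun i => (measurable_mismatch _ _).comp_aemeasurable (hy i).aemeasurable)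
    (fun _ _ => mismatch_eq_or _ _ _) (fun i => integral_mismatch_le (hy i) (hg i) he) hr

/-- In dimension at least two, the decoded sum almost surely does not vanish. -/
lemma measure_sum_sgn_smul_eq_zero [Nonempty ι] (hd : 2 ≤ d)
    (hy : ∀ i, HasLaw (y i) (sphereLaw d) P) (hi : iIndepFun y P) (g : ι → Vec d) :
    P {ω | ∑ i, sgn ⟪g i, y i ω⟫_ℝ • y i ω = 0} = 0 := by
  classical
  have : IsProbabilityMeasure P := hi.isProbabilityMeasure
  obtain ⟨k⟩ := ‹Nonempty ι›
  have : IsProbabilityMeasure (sphereLaw d) := (hy k).isProbabilityMeasure_iff.1 ‹_›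
  let f : ι → Vec d → Vec d := fun i v => sgn ⟪g i, v⟫_ℝ • v
  have hf : ∀ i, Measurable (f i) := fun i =>
    (measurable_sgn.comp (by fun_prop)).smul measurable_id
  have hfm : ∀ i, AEMeasurable (fun ω => f i (y i ω)) P := fun i =>
    (hf i).comp_aemeasurable (hy i).aemeasurable
  set S : Ω → Vec d := fun ω => ∑ i ∈ Finset.univ.erase k, f i (y i ω) with hS
  have hSm : AEMeasurable S P := Finset.aemeasurable_fun_sum _ fun j _ => hfm j
  have hind : IndepFun S (y k) P := by
    have h := hi.indepFun_finset₀ (Finset.univ.erase k) {k}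
      (Finset.disjoint_singleton_right.2 (by simp)) fun i => (hy i).aemeasurable
    have hψ : Measurable fun w : ({k} : Finset ι) → Vec d => w ⟨k, by simp⟩ :=
      measurable_pi_apply _
    have h' := h.comp (φ := fun w => ∑ i : ↥(Finset.univ.erase k), f i (w i))
      (ψ := fun w => w ⟨k, by simp⟩)
      (Finset.measurable_fun_sum _ fun i _ => (hf i).comp (measurable_pi_apply i))
      hψ
    convert h' using 1
    · ext1 ω
      simp only [hS, Function.comp_apply]
      exact (Finset.sum_coe_sort (Finset.univ.erase k) fun i => f i (y i ω)).symm
    · rfl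
  have hlaw := (indepFun_iff_map_prod_eq_prod_map_map hSm (hy k).aemeasurable).1 hind
  rw [(hy k).map_eq] at hlaw
  set B : Set (Vec d × Vec d) := {p | p.1 + f k p.2 = 0} with hB
  have hBm : MeasurableSet B :=
    measurableSet_eq_fun (measurable_fst.add ((hf k).comp measurable_snd)) measurable_const
  have h0 : P.map (fun ω => (S ω, y k ω)) B = 0 := by
    have : SFinite (P.map S) := inferInstance
    rw [hlaw, Measure.measure_prod_null hBm]
    refine Filter.Eventually.of_forall fun s => ?_
    -- Once the other summands total `s`, cancellation confines the remaining point to `-s` or `s`,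
    -- and points are null.
    have hsub : Prod.mk s ⁻¹' B ⊆ {-s} ∪ {s} := by
      intro v hv
      simp only [hB, Set.mem_preimage, Set.mem_ofPred_eq, f] at hv
      simp only [Set.mem_union, Set.mem_singleton_iff]
      rcases sgn_eq_or ⟪g k, v⟫_ℝ with h | h
      · left
        rw [h, one_smul] at hv
        exact (neg_eq_of_add_eq_zero_right hv).symm
      · right
        rw [h, neg_one_smul, ← sub_eq_add_neg] at hv
        exact (sub_eq_zero.1 hv).symm
    exact measure_mono_null hsub
      (measure_union_null (sphereLaw_singleton hd _) (sphereLaw_singleton hd _))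
  rw [Measure.map_apply_of_aemeasurable (hSm.prodMk (hy k).aemeasurable) hBm] at h0
  convert h0 using 2
  ext ω
  simp only [hB, hS, Set.mem_preimage, Set.mem_ofPred_eq]
  rw [Finset.sum_erase_add _ _ (Finset.mem_univ k)]

end Vectors

/-! ### Deterministic geometry of the decoder -/

section Deterministic

variable {d : ℕ}

lemma norm_normalize {v : Vec d} (hv : v ≠ 0) : ‖normalize v‖ = 1 := by
  rw [normalize, norm_smul, norm_inv, norm_norm, inv_mul_cancel₀ (norm_ne_zero_iff.2 hv)]

lemma normalize_smul {c : ℝ} (hc : 0 < c) (v : Vec d) : normalize (c • v) = normalize v := by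
  rw [normalize, normalize, norm_smul, Real.norm_eq_abs, abs_of_pos hc, smul_smul, mul_inv,
    mul_right_comm, inv_mul_cancel₀ hc.ne', one_mul]

lemma normalize_avg {m : ℕ} (hm : 0 < m) (v : Fin m → Vec d) :
    normalize (avg v) = normalize (∑ i, v i) :=
  normalize_smul (by positivity) _

lemma sgn_eq_sgn_mul_mismatch (u v y : Vec d) :
    sgn ⟪u, y⟫_ℝ = sgn ⟪v, y⟫_ℝ * (1 - 2 * mismatch u v y) := by
  unfold mismatch
  split_ifs with h
  · rcases sgn_eq_or ⟪u, y⟫_ℝ with h1 | h1 <;> rcases sgn_eq_or ⟪v, y⟫_ℝ with h2 | h2 <;>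
      simp [h1, h2] at h ⊢ <;> norm_num
  · rw [not_ne_iff.1 h]
    ring

variable {ι : Type*} [Fintype ι] {g y : ι → Vec d} {e : Vec d}

/-- A wrong bit turns a contribution `|⟪e, y i⟫| ≤ 1` into its negative, losing at most 2. -/
lemma le_inner_sum_sgn_smul (he : ‖e‖ = 1) (hy : ∀ i, ‖y i‖ = 1) :
    ∑ i, |⟪e, y i⟫_ℝ| - 2 * ∑ i, mismatch (g i) e (y i) ≤
      ⟪∑ i, sgn ⟪g i, y i⟫_ℝ • y i, e⟫_ℝ := by
  rw [sum_inner, Finset.mul_sum, ← Finset.sum_sub_distrib]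
  refine Finset.sum_le_sum fun i _ => ?_
  rw [inner_smul_left, RCLike.conj_to_real, real_inner_comm e, sgn_eq_sgn_mul_mismatch (g i) e,
    mul_right_comm, sgn_mul_self]
  have h1 : |⟪e, y i⟫_ℝ| ≤ 1 := by simpa [he, hy i] using abs_real_inner_le_norm e (y i)
  rcases mismatch_eq_or (g i) e (y i) with h | h <;> rw [h] <;> linarith

lemma norm_perp_sum_sgn_smul_le (he : ‖e‖ = 1) (hy : ∀ i, ‖y i‖ = 1) :
    ‖∑ i, sgn ⟪g i, y i⟫_ℝ • y i - ⟪e, ∑ i, sgn ⟪g i, y i⟫_ℝ • y i⟫_ℝ • e‖ ≤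
      ‖∑ i, foldPerp e (y i)‖ + 2 * ∑ i, mismatch (g i) e (y i) := by
  have h1 : ∑ i, sgn ⟪g i, y i⟫_ℝ • y i - ⟪e, ∑ i, sgn ⟪g i, y i⟫_ℝ • y i⟫_ℝ • e =
      ∑ i, foldPerp e (y i) - ∑ i, (2 * mismatch (g i) e (y i)) • foldPerp e (y i) := by
    rw [inner_sum, Finset.sum_smul, ← Finset.sum_sub_distrib, ← Finset.sum_sub_distrib]
    refine Finset.sum_congr rfl fun i _ => ?_
    rw [foldPerp, inner_smul_right, sgn_eq_sgn_mul_mismatch (g i) e]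
    module
  rw [h1]
  refine (norm_sub_le _ _).trans (add_le_add le_rfl ?_)
  rw [Finset.mul_sum]
  refine (norm_sum_le _ _).trans (Finset.sum_le_sum fun i _ => ?_)
  have h0 : 0 ≤ 2 * mismatch (g i) e (y i) := by
    rcases mismatch_eq_or (g i) e (y i) with h | h <;> simp [h]
  rw [norm_smul, Real.norm_eq_abs, abs_of_nonneg h0]
  exact mul_le_of_le_one_right h0 (norm_foldPerp_le he (hy i))

/-- The hypothesis says that the tangent of the angle is at most `θ`, so its cosine is at least `1 /
√(θ ^ 2 + 1)`, which dominates `cos θ` in the stated range. -/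
lemma cos_le_inner_normalize {x : Vec d} (he : ‖e‖ = 1) {θ : ℝ} (h0 : 0 ≤ θ)
    (hθ : θ ≤ 3 * Real.pi / 2) (hx : 0 < ⟪x, e⟫_ℝ) (hp : ‖x - ⟪e, x⟫_ℝ • e‖ ≤ θ * ⟪x, e⟫_ℝ) :
    Real.cos θ ≤ ⟪normalize x, e⟫_ℝ := by
  have hx0 : x ≠ 0 := by
    rintro rfl
    simp at hx
  have hn : 0 < ‖x‖ := norm_pos_iff.2 hx0
  have h1 : ‖x - ⟪e, x⟫_ℝ • e‖ ^ 2 = ‖x‖ ^ 2 - ⟪x, e⟫_ℝ ^ 2 := by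
    rw [norm_sub_sq_real, norm_smul, inner_smul_right, he, Real.norm_eq_abs, mul_one, sq_abs,
      real_inner_comm]
    ring
  have h2 : ‖x - ⟪e, x⟫_ℝ • e‖ ^ 2 ≤ (θ * ⟪x, e⟫_ℝ) ^ 2 :=
    pow_le_pow_left₀ (norm_nonneg _) hp 2
  have h3 : ‖x‖ ≤ √(θ ^ 2 + 1) * ⟪x, e⟫_ℝ := by
    refine le_of_sq_le_sq ?_ (by positivity)
    rw [mul_pow, Real.sq_sqrt (by positivity)]
    linarith
  refine (Real.cos_le_one_div_sqrt_sq_add_one (by linarith [Real.pi_pos]) hθ).trans ?_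
  rw [normalize, inner_smul_left, RCLike.conj_to_real, inv_mul_eq_div,
    div_le_div_iff₀ (by positivity) hn]
  linarith

/-- In dimension one the bit together with the shared vector determines the client vector. -/
lemma sgn_inner_smul_eq {u v : Vec 1} (hu : ‖u‖ = 1) (hv : ‖v‖ = 1) : sgn ⟪u, v⟫_ℝ • v = u := by
  have h1 : ∀ w : Vec 1, ‖w‖ = 1 → w 0 = 1 ∨ w 0 = -1 := by
    intro w hw
    have := EuclideanSpace.real_norm_sq_eq w
    rw [hw] at this
    simpa using this.symm
  ext i
  fin_cases i
  have hin : ⟪u, v⟫_ℝ = u 0 * v 0 := by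
    simp [PiLp.inner_apply, mul_comm]
  rw [hin]
  rcases h1 u hu with h | h <;> rcases h1 v hv with h' | h' <;> simp [h, h', sgn]
  all_goals norm_num
  all_goals linarith

end Deterministic

/-! ### Translation to the scheme's definitions -/

section Scheme

variable {d m : ℕ} {g : Fin m → Sphere d}

lemma norm_coe_sphere (z : Sphere d) : ‖(z : Vec d)‖ = 1 := by simp

lemma norm_target (hm : 0 < m) (hg : ∑ i, (g i : Vec d) ≠ 0) : ‖target g‖ = 1 := by
  rw [target, normalize_avg hm]
  exact norm_normalize hg

lemma output_eq (hm : 0 < m) (z : Fin m → Sphere d) :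
    output g z = normalize (∑ i, sgn ⟪(g i : Vec d), (z i : Vec d)⟫_ℝ • (z i : Vec d)) :=
  normalize_avg hm _

lemma mul_deltaCorr (hm : 0 < m) :
    m * deltaCorr g = ∑ i, Real.arccos ⟪(g i : Vec d), target g⟫_ℝ / Real.pi := by
  have : (0 : ℝ) < m := by exact_mod_cast hm
  have := Real.pi_pos
  rw [deltaCorr, ← Finset.sum_div]
  field_simp

lemma deltaCorr_nonneg : 0 ≤ deltaCorr g :=
  mul_nonneg (div_nonneg zero_le_one (mul_nonneg (Nat.cast_nonneg _) Real.pi_pos.le))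
    (Finset.sum_nonneg fun _ _ => Real.arccos_nonneg _)

lemma zeta_eq (z : Fin m → Sphere d) :
    zeta g z = (∑ i, mismatch (g i : Vec d) (target g) (z i : Vec d)) / m := by
  simp only [zeta, mismatch, Finset.sum_boole, encode]
  congr!

lemma success_of_ne_zero (hm : 0 < m) (hg : ∑ i, (g i : Vec d) ≠ 0) {K δ : ℝ}
    {z : Fin m → Sphere d} (hz : ∑ i, sgn ⟪(g i : Vec d), (z i : Vec d)⟫_ℝ • (z i : Vec d) ≠ 0)
    (he : Real.pi ≤ errorBound K δ g) : Success K δ g z := by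
  have h1 : ‖output g z‖ = 1 := by rw [output_eq hm]; exact norm_normalize hz
  refine ⟨h1, ?_⟩
  rw [min_eq_left he, Real.cos_pi]
  have h2 := (abs_le.1 (abs_real_inner_le_norm (output g z) (target g))).1
  rwa [h1, norm_target hm hg, one_mul] at h2

lemma success_of_cos_le (hm : 0 < m) {K δ : ℝ} {z : Fin m → Sphere d}
    (hx : 0 < ⟪∑ i, sgn ⟪(g i : Vec d), (z i : Vec d)⟫_ℝ • (z i : Vec d), target g⟫_ℝ)
    (he : errorBound K δ g ≤ Real.pi)
    (hc : Real.cos (errorBound K δ g) ≤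
      ⟪normalize (∑ i, sgn ⟪(g i : Vec d), (z i : Vec d)⟫_ℝ • (z i : Vec d)), target g⟫_ℝ) :
    Success K δ g z := by
  refine ⟨?_, ?_⟩
  · rw [output_eq hm]
    refine norm_normalize fun h => ?_
    rw [h, inner_zero_left] at hx
    exact hx.false
  · rwa [min_eq_right he, output_eq hm]

lemma success_of_dim_one {g : Fin m → Sphere 1} (hm : 0 < m) (hg : ∑ i, (g i : Vec 1) ≠ 0)
    {K δ : ℝ} (z : Fin m → Sphere 1) : Success K δ g z := by
  have h : output g z = target g := by
    rw [output_eq hm, target, normalize_avg hm]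
    congr 1
    exact Finset.sum_congr rfl fun i _ =>
      sgn_inner_smul_eq (norm_coe_sphere (g i)) (norm_coe_sphere (z i))
  have ht := norm_target hm hg
  refine ⟨by rw [h, ht], ?_⟩
  rw [h, real_inner_self_eq_norm_sq, ht, one_pow]
  exact Real.cos_le_one _

end Scheme

/-! ### Numerical estimates for the constants -/

section Numeric

/-- A lower bound for the mean absolute value of a coordinate of a uniform point. -/
noncomputable def coordBound (D : ℝ) : ℝ := √((D + 2) / 3) / D

variable {D M Δ L : ℝ}

lemma coordBound_sq (hD : 2 ≤ D) : coordBound D ^ 2 * (3 * D ^ 2) = D + 2 := by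
  rw [coordBound, div_pow, Real.sq_sqrt (by linarith)]
  field_simp

lemma coordBound_pos (hD : 2 ≤ D) : 0 < coordBound D :=
  div_pos (Real.sqrt_pos.2 (by linarith)) (by linarith)

lemma le_coordBound_mul_sqrt (hD : 2 ≤ D) : 57 / 100 ≤ coordBound D * √D := by
  have h := coordBound_sq hD
  refine le_of_sq_le_sq ?_ (mul_nonneg (coordBound_pos hD).le (Real.sqrt_nonneg _))
  rw [mul_pow, Real.sq_sqrt (by linarith)]
  nlinarith

lemma le_coordBound_mul (hD : 2 ≤ D) : 115 / 100 ≤ coordBound D * D := by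
  have h := coordBound_sq hD
  refine le_of_sq_le_sq ?_ (mul_nonneg (coordBound_pos hD).le (by linarith))
  rw [mul_pow]
  nlinarith

lemma sq_mul_le_of_div_sqrt_mul_sqrt_le (hD : 0 < D) (hM : 0 < M) (hL : 0 ≤ L) {c : ℝ}
    (h : D / √M * √L ≤ c) : D ^ 2 * L ≤ c ^ 2 * M := by
  have h1 : (D / √M * √L) ^ 2 ≤ c ^ 2 := pow_le_pow_left₀ (by positivity) h 2
  rw [mul_pow, div_pow, Real.sq_sqrt hM.le, Real.sq_sqrt hL, div_mul_eq_mul_div,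
    div_le_iff₀ hM] at h1
  exact h1

lemma exponent_coarse (hD : 2 ≤ D) (hM : 0 < M) (hL : 0 ≤ L) (h : D / √M * √L ≤ 1) :
    3 / 2 * L ≤ 2 * M * (9 / 10 * coordBound D) ^ 2 := by
  have h1 := sq_mul_le_of_div_sqrt_mul_sqrt_le (by linarith) hM hL h
  have h2 := coordBound_sq hD
  have h3 : coordBound D ^ 2 * (D ^ 2 * L) ≤ coordBound D ^ 2 * (1 ^ 2 * M) :=
    mul_le_mul_of_nonneg_left h1 (sq_nonneg _)
  have h4 : coordBound D ^ 2 * (D ^ 2 * L) = (D + 2) / 3 * L := by rw [← h2]; ring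
  nlinarith

/-- The fraction `3 / 8` is exactly enough at `D = 2`: `2 * (9 / 64) * 4 * (4 / 3) = 3 / 2`. -/
lemma exponent_fine (hD : 2 ≤ D) (hM : 0 < M) (hL : 0 ≤ L) (h : D / √M * √L ≤ 1 / 2) :
    3 / 2 * L ≤ 2 * M * (3 / 8 * coordBound D) ^ 2 := by
  have h1 := sq_mul_le_of_div_sqrt_mul_sqrt_le (by linarith) hM hL h
  have h2 := coordBound_sq hD
  have h3 : coordBound D ^ 2 * (D ^ 2 * L) ≤ coordBound D ^ 2 * ((1 / 2) ^ 2 * M) :=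
    mul_le_mul_of_nonneg_left h1 (sq_nonneg _)
  have h4 : coordBound D ^ 2 * (D ^ 2 * L) = (D + 2) / 3 * L := by rw [← h2]; ring
  nlinarith

/-- A factor strictly below `9 / 10` is what conditioning on `ζ < 1/2` requires later. -/
lemma exp_neg_log_bounds {δ : ℝ} (hD : 2 ≤ D) (h0 : 0 < δ) (h1 : δ < 1) :
    2 * Real.exp (-(2 * Real.log (D / δ))) + Real.exp (-(3 / 2 * Real.log (D / δ))) ≤
      87 / 100 * δ := by
  have hD0 : 0 < D := by linarith
  set L := Real.log (D / δ) with hL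
  have e1 : Real.exp (-L) = δ / D := by
    rw [Real.exp_neg, hL, Real.exp_log (by positivity), inv_div]
  have e2 : Real.exp (-(2 * L)) = Real.exp (-L) * Real.exp (-L) := by
    rw [← Real.exp_add]; ring_nf
  have e3 : Real.exp (-(3 / 2 * L)) = Real.exp (-L) * Real.exp (-(L / 2)) := by
    rw [← Real.exp_add]; ring_nf
  have h2 : Real.exp (-L) ≤ δ / 2 := by
    rw [e1]
    exact div_le_div_of_nonneg_left h0.le two_pos hD
  have h3 : Real.exp (-(L / 2)) ≤ 72 / 100 := by
    refine le_of_sq_le_sq ?_ (by norm_num)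
    have : Real.exp (-(L / 2)) ^ 2 = Real.exp (-L) := by
      rw [sq, ← Real.exp_add]; ring_nf
    rw [this]
    linarith
  have hp := Real.exp_pos (-L)
  have hq := Real.exp_pos (-(L / 2))
  rw [e2, e3]
  have h4 : Real.exp (-L) * Real.exp (-L) ≤ δ / 2 * (1 / 2) :=
    mul_le_mul h2 (by linarith) hp.le (by linarith)
  have h5 : Real.exp (-L) * Real.exp (-(L / 2)) ≤ δ / 2 * (72 / 100) :=
    mul_le_mul h2 h3 hq.le (by linarith)
  linarith

lemma coarse_margin (hD : 2 ≤ D) (hM : 0 < M) (hΔ : 1000 * (√D * Δ) ≤ 1) {N A : ℝ}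
    (hN : N < 5 * (M * Δ)) (hA : M * (coordBound D - 9 / 10 * coordBound D) < A) :
    0 < A - 2 * N := by
  have hs : 0 < √D := Real.sqrt_pos.2 (by linarith)
  have h1 := le_coordBound_mul_sqrt hD
  have h2 : 10 * Δ ≤ coordBound D - 9 / 10 * coordBound D := by
    refine le_of_mul_le_mul_right ?_ hs
    linarith
  have h3 := mul_le_mul_of_nonneg_left h2 hM.le
  linarith

lemma fine_margin (hD : 2 ≤ D) (hM : 0 < M) (hΔ : 0 ≤ Δ)
    (hs : 1000 * (√D * Δ) + D / √M * √L ≤ 1 / 2) {N A S : ℝ}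
    (hN : N < 5 * (M * Δ)) (hA : M * (coordBound D - 3 / 8 * coordBound D) < A)
    (hS : S < 2 * √(M * L)) :
    0 < A - 2 * N ∧
      S + 2 * N ≤ Real.pi * (1000 * (√D * Δ) + D / √M * √L) * (A - 2 * N) := by
  have hq : 0 < √D := Real.sqrt_pos.2 (by linarith)
  have hc := coordBound_pos hD
  have hM' : 0 < √M := Real.sqrt_pos.2 hM
  set c := coordBound D
  set t := D / √M * √L with ht
  have ht0 : 0 ≤ t := mul_nonneg (div_nonneg (by linarith) hM'.le) (Real.sqrt_nonneg _)
  have hw0 : 0 ≤ √D * Δ := by positivity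
  have h1 : 57 / 100 ≤ c * √D := le_coordBound_mul_sqrt hD
  have h2 : 115 / 100 ≤ c * D := le_coordBound_mul hD
  have hΔ' : 10 * Δ ≤ c / 40 := by
    refine le_of_mul_le_mul_right ?_ hq
    linarith
  have hMc : 0 < M * c := mul_pos hM hc
  -- `5 / 8 - 1 / 40 = 6 / 10`: the Hoeffding loss and the wrong bits. With `π > 3` this gives the
  -- `18 / 10` and `1800` below.
  have hA' : 6 / 10 * (M * c) ≤ A - 2 * N := by
    have := mul_le_mul_of_nonneg_left hΔ' hM.le
    linarith
  have hτ : √(M * L) * D = M * t := by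
    rw [ht, Real.sqrt_mul hM.le]
    field_simp
    rw [Real.sq_sqrt hM.le, mul_comm]
  have hτ' : 2 * √(M * L) ≤ 18 / 10 * (t * (M * c)) := by
    have h3 : 115 / 100 * √(M * L) ≤ c * D * √(M * L) :=
      mul_le_mul_of_nonneg_right h2 (Real.sqrt_nonneg _)
    have h4 : c * D * √(M * L) = t * (M * c) := by linear_combination c * hτ
    have := Real.sqrt_nonneg (M * L)
    linarith
  have hN' : 10 * (M * Δ) ≤ 1800 * (√D * Δ * (M * c)) := by
    have h3 : 57 / 100 * (M * Δ) ≤ c * √D * (M * Δ) :=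
      mul_le_mul_of_nonneg_right h1 (by positivity)
    have h4 : c * √D * (M * Δ) = √D * Δ * (M * c) := by ring
    have : 0 ≤ M * Δ := by positivity
    linarith
  refine ⟨lt_of_lt_of_le (by positivity) hA', ?_⟩
  have h5 : 3 * (1000 * (√D * Δ) + t) * (6 / 10 * (M * c)) ≤
      Real.pi * (1000 * (√D * Δ) + t) * (A - 2 * N) :=
    mul_le_mul (mul_le_mul_of_nonneg_right Real.pi_gt_three.le (by positivity)) hA'
      (by positivity) (mul_nonneg Real.pi_pos.le (by positivity))
  linarith

end Numeric

/-! ### Probability of success, with and without conditioning -/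

section Probability

/-- Bound the conditional probability of failure by `P Fᶜ / P A`. Only subadditivity is used, so
neither event has to be shown measurable. -/
lemma one_sub_le_cond_real {Ω : Type*} [MeasurableSpace Ω] {P : Measure Ω} [IsProbabilityMeasure P]
    {A F : Set Ω} {a b : ℝ} (hA : P A ≠ 0) (hF : P.real Fᶜ ≤ a) (hAc : P.real Aᶜ ≤ b)
    (hb : b < 1) : 1 - a / (1 - b) ≤ (P[|A]).real F := by
  have : IsProbabilityMeasure (P[|A]) := cond_isProbabilityMeasure hA
  have h1 : 1 - b ≤ P.real A := by
    have := measureReal_union_le (μ := P) A Aᶜ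
    rw [Set.union_compl_self, probReal_univ] at this
    linarith
  have h2 : 1 ≤ (P[|A]).real F + (P[|A]).real Fᶜ := by
    have := measureReal_union_le (μ := P[|A]) F Fᶜ
    rwa [Set.union_compl_self, probReal_univ] at this
  have h3 : (P[|A]).real Fᶜ = (P.real A)⁻¹ * (P.restrict A).real Fᶜ := by
    simp [ProbabilityTheory.cond, measureReal_def, ENNReal.toReal_inv]
  have h4 : (P.restrict A).real Fᶜ ≤ P.real Fᶜ :=
    ENNReal.toReal_mono (measure_ne_top _ _) (Measure.restrict_apply_le _ _)
  have h5 : (P[|A]).real Fᶜ ≤ a / (1 - b) := by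
    rw [h3, div_eq_inv_mul]
    exact mul_le_mul (inv_anti₀ (by linarith) h1) (h4.trans hF) measureReal_nonneg
      (inv_nonneg.2 (by linarith))
  linarith

variable {d m : ℕ} {g : Fin m → Sphere d} {Ω : Type*} [MeasurableSpace Ω] {P : Measure Ω}
  {z : Fin m → Ω → Sphere d}

lemma hasLaw_coe {X : Ω → Sphere d} (hX : HasLaw X (unifSphere d) P) :
    HasLaw (fun ω => (X ω : Vec d)) (sphereLaw d) P :=
  HasLaw.fun_comp ⟨measurable_subtype_coe.aemeasurable, rfl⟩ hX

lemma iIndepFun_coe (hi : iIndepFun z P) : iIndepFun (fun i ω => (z i ω : Vec d)) P :=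
  hi.comp (fun _ => Subtype.val) fun _ => measurable_subtype_coe

lemma measure_not_success_eq_zero (hd : 2 ≤ d) (hm : 0 < m) (hg : ∑ i, (g i : Vec d) ≠ 0)
    (hz : ∀ i, HasLaw (z i) (unifSphere d) P) (hi : iIndepFun z P) {K δ : ℝ}
    (he : Real.pi ≤ errorBound K δ g) : P {ω | Success K δ g fun i => z i ω}ᶜ = 0 := by
  have : Nonempty (Fin m) := ⟨⟨0, hm⟩⟩
  refine measure_mono_null (fun ω hω => ?_)
    (measure_sum_sgn_smul_eq_zero hd (fun i => hasLaw_coe (hz i)) (iIndepFun_coe hi)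
      fun i => (g i : Vec d))
  by_contra hne
  exact hω (success_of_ne_zero hm hg hne he)

lemma measure_not_success_le (hd : 2 ≤ d) (hm : 0 < m) (hg : ∑ i, (g i : Vec d) ≠ 0)
    (hz : ∀ i, HasLaw (z i) (unifSphere d) P) (hi : iIndepFun z P) {δ : ℝ} (h0 : 0 < δ)
    (h1 : δ < 1) (he : errorBound 1000 δ g < Real.pi) :
    P.real {ω | Success 1000 δ g fun i => z i ω}ᶜ ≤
      87 / 100 * δ + Real.exp (-(m * deltaCorr g)) := by
  have : Nonempty (Fin m) := ⟨⟨0, hm⟩⟩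
  have hprob : IsProbabilityMeasure P := hi.isProbabilityMeasure
  have hpi := Real.pi_pos
  have hD : (2 : ℝ) ≤ d := by exact_mod_cast hd
  have hM : (0 : ℝ) < m := by exact_mod_cast hm
  have ht := norm_target hm hg
  have hΔ := deltaCorr_nonneg (g := g)
  set e := target g with he_def
  set Δ := deltaCorr g with hΔ_def
  set L := Real.log (d / δ) with hL_def
  have hL : 0 ≤ L := Real.log_nonneg (by rw [le_div_iff₀ h0]; linarith)
  have hw0 : 0 ≤ √(d : ℝ) * Δ := by positivity
  have ht0 : 0 ≤ (d : ℝ) / √(m : ℝ) * √L := by positivity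
  have hE : errorBound 1000 δ g = Real.pi * (1000 * (√(d : ℝ) * Δ) + d / √(m : ℝ) * √L) := rfl
  set s := 1000 * (√(d : ℝ) * Δ) + d / √(m : ℝ) * √L with hs_def
  have hs1 : s < 1 := by
    rw [hE] at he
    exact lt_of_mul_lt_mul_left (by linarith) hpi.le
  have hy := fun i => hasLaw_coe (hz i)
  have hiy := iIndepFun_coe hi
  have hgn := fun i => norm_coe_sphere (g i)
  set N : Ω → ℝ := fun ω => ∑ i, mismatch (g i : Vec d) e (z i ω : Vec d) with hN_def
  set A : Ω → ℝ := fun ω => ∑ i, |⟪e, (z i ω : Vec d)⟫_ℝ| with hA_def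
  set S : Ω → ℝ := fun ω => ‖∑ i, foldPerp e (z i ω : Vec d)‖ with hS_def
  have bN : P.real {ω | 5 * (m * Δ) ≤ N ω} ≤ Real.exp (-(m * Δ)) := by
    have := measure_sum_mismatch_ge_le hy hiy hgn ht
    rwa [← mul_deltaCorr hm] at this
  have bS : P.real {ω | 2 * √(m * L) ≤ S ω} ≤ 2 * Real.exp (-(2 * L)) := by
    have := measure_norm_sum_foldPerp_ge_le hy hiy ht (r := 2 * √(m * L)) (by positivity)
    rw [Fintype.card_fin, mul_pow, Real.sq_sqrt (by positivity)] at this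
    convert this using 3
    field_simp
  have bA : ∀ x : ℝ, 0 ≤ x → 3 / 2 * L ≤ 2 * m * x ^ 2 →
      P.real {ω | A ω ≤ m * (coordBound d - x)} ≤ Real.exp (-(3 / 2 * L)) := by
    intro x hx hxL
    have := measure_sum_abs_inner_le_le (by omega) hy hiy ht hx
    rw [Fintype.card_fin] at this
    exact this.trans (Real.exp_le_exp.2 (by linarith))
  have hin : ∀ ω, A ω - 2 * N ω ≤
      ⟪∑ i, sgn ⟪(g i : Vec d), (z i ω : Vec d)⟫_ℝ • (z i ω : Vec d), e⟫_ℝ := fun ω =>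
    le_inner_sum_sgn_smul ht fun i => norm_coe_sphere (z i ω)
  have hbad := exp_neg_log_bounds hD h0 h1
  -- Two regimes. For `s ≥ 1/2` the allowed angle is at least `π / 2`, so a positive inner product
  -- suffices and almost all of the mean may be given away. For `s ≤ 1/2` the tangent is controlled,
  -- at the cost of a smaller deviation `x`.
  obtain ⟨x, hx0, hxL, hx⟩ : ∃ x : ℝ, 0 ≤ x ∧ 3 / 2 * L ≤ 2 * m * x ^ 2 ∧
      ∀ ω, N ω < 5 * (m * Δ) → m * (coordBound d - x) < A ω → S ω < 2 * √(m * L) →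
        Success 1000 δ g fun i => z i ω := by
    have hc := coordBound_pos hD
    rcases le_total (1 / 2) s with hs | hs
    · refine ⟨9 / 10 * coordBound d, by positivity, exponent_coarse hD hM hL (by linarith),
        fun ω h2 h3 _ => ?_⟩
      have hpos := (coarse_margin hD hM (by linarith) h2 h3).trans_le (hin ω)
      refine success_of_cos_le hm hpos he.le ?_
      refine (Real.cos_nonpos_of_pi_div_two_le_of_le ?_ ?_).trans ?_
      · rw [hE]
        nlinarith
      · linarith
      · rw [normalize, inner_smul_left, RCLike.conj_to_real]
        exact mul_nonneg (inv_nonneg.2 (norm_nonneg _)) hpos.le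
    · refine ⟨3 / 8 * coordBound d, by positivity, exponent_fine hD hM hL (by linarith),
        fun ω h2 h3 h4 => ?_⟩
      obtain ⟨h5, h6⟩ := fine_margin hD hM hΔ hs h2 h3 h4
      have hpos := h5.trans_le (hin ω)
      refine success_of_cos_le hm hpos he.le ?_
      have hE0 : 0 ≤ errorBound 1000 δ g := by rw [hE]; positivity
      refine cos_le_inner_normalize ht hE0 (by linarith) hpos ?_
      refine (norm_perp_sum_sgn_smul_le ht fun i => norm_coe_sphere (z i ω)).trans (h6.trans ?_)
      exact mul_le_mul_of_nonneg_left (hin ω) hE0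
  have hsub : {ω | Success 1000 δ g fun i => z i ω}ᶜ ⊆
      ({ω | 5 * (m * Δ) ≤ N ω} ∪ {ω | A ω ≤ m * (coordBound d - x)}) ∪
        {ω | 2 * √(m * L) ≤ S ω} := by
    intro ω hω
    by_contra hc
    simp only [Set.mem_union, Set.mem_ofPred_eq, not_or, not_le] at hc
    exact hω (hx ω hc.1.1 hc.1.2 hc.2)
  have u1 := measureReal_mono (μ := P) hsub
  have u2 := measureReal_union_le (μ := P)
    ({ω | 5 * (m * Δ) ≤ N ω} ∪ {ω | A ω ≤ m * (coordBound d - x)}) {ω | 2 * √(m * L) ≤ S ω}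
  have u3 := measureReal_union_le (μ := P) {ω | 5 * (m * Δ) ≤ N ω}
    {ω | A ω ≤ m * (coordBound d - x)}
  have u4 := bA x hx0 hxL
  linarith

lemma measure_zeta_ge_le (hm : 0 < m) (hg : ∑ i, (g i : Vec d) ≠ 0) [IsProbabilityMeasure P]
    (hz : ∀ i, HasLaw (z i) (unifSphere d) P) :
    P.real {ω | zeta g (fun i => z i ω) < 1 / 2}ᶜ ≤ 4 * deltaCorr g := by
  have hM : (0 : ℝ) < m := by exact_mod_cast hm
  have h := measure_sum_mismatch_ge_le_div (fun i => hasLaw_coe (hz i))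
    (fun i => norm_coe_sphere (g i)) (norm_target hm hg) (r := m / 2) (by positivity)
  rw [← mul_deltaCorr hm, show 2 * (m * deltaCorr g) / (m / 2) = 4 * deltaCorr g by
    field_simp; ring] at h
  refine (measureReal_mono fun ω hω => ?_).trans h
  simp only [Set.mem_compl_iff, Set.mem_ofPred_eq, not_lt, zeta_eq] at hω ⊢
  rw [le_div_iff₀ hM] at hω
  linarith

end Probability

end OneBit

/-! ### The main theorem -/

theorem mainTheorem6 :
    ∃ K C : ℝ, 0 < K ∧ 0 < C ∧
      ∀ (d m : ℕ) (g : Fin m → OneBit.Sphere d),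
        ∑ i, (g i : OneBit.Vec d) ≠ 0 →
      ∀ (Ω : Type*) (_ : MeasurableSpace Ω) (P : Measure Ω) (_ : IsProbabilityMeasure P)
        (z : Fin m → Ω → OneBit.Sphere d),
        (∀ i, HasLaw (z i) (OneBit.unifSphere d) P) →
        iIndepFun z P →
      ∀ δ : ℝ, 0 < δ → δ < 1 →
        1 - δ - C * Real.exp (-(m * OneBit.deltaCorr g)) ≤
            P.real {ω | OneBit.Success K δ g fun i => z i ω} ∧
        (P {ω | OneBit.zeta g (fun i => z i ω) < 1 / 2} ≠ 0 →
          1 - δ - C * Real.exp (-(m * OneBit.deltaCorr g)) ≤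
            (P[|{ω | OneBit.zeta g (fun i => z i ω) < 1 / 2}]).real
              {ω | OneBit.Success K δ g fun i => z i ω}) := by
  refine ⟨1000, 2, by norm_num, by norm_num, ?_⟩
  intro d m g hg Ω _ P _ z hz hi δ h0 h1
  have hm : 0 < m := by
    rcases Nat.eq_zero_or_pos m with rfl | h
    · simp at hg
    · exact h
  set ε := Real.exp (-(m * OneBit.deltaCorr g)) with hε
  have hε0 : 0 < ε := Real.exp_pos _
  set F : Set Ω := {ω | OneBit.Success 1000 δ g fun i => z i ω} with hF
  set A : Set Ω := {ω | OneBit.zeta g (fun i => z i ω) < 1 / 2} with hA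
  -- Used with `a = 87/100 * δ + ε` and `b = 1/10`, where `a ≤ 9/10 * (δ + 2 * ε)`; this is why `C =
  -- 2`.
  have key : ∀ a b : ℝ, P.real Fᶜ ≤ a → P.real Aᶜ ≤ b → b < 1 → a ≤ (1 - b) * (δ + 2 * ε) →
      1 - δ - 2 * ε ≤ P.real F ∧ (P A ≠ 0 → 1 - δ - 2 * ε ≤ (P[|A]).real F) := by
    intro a b ha hb hb1 hab
    have hb0 : 0 ≤ b := measureReal_nonneg.trans hb
    refine ⟨?_, fun hA0 => ?_⟩
    · have h2 := measureReal_union_le (μ := P) F Fᶜ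
      rw [Set.union_compl_self, probReal_univ] at h2
      nlinarith
    · have h2 := OneBit.one_sub_le_cond_real hA0 ha hb hb1
      have h3 : a / (1 - b) ≤ δ + 2 * ε := by
        rw [div_le_iff₀ (by linarith)]
        linarith
      linarith
  have null : P Fᶜ = 0 →
      1 - δ - 2 * ε ≤ P.real F ∧ (P A ≠ 0 → 1 - δ - 2 * ε ≤ (P[|A]).real F) := by
    intro hF0
    refine ⟨?_, fun hA0 => ?_⟩
    · have h2 := measureReal_union_le (μ := P) F Fᶜ
      rw [Set.union_compl_self, probReal_univ, measureReal_def P Fᶜ, hF0,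
        ENNReal.toReal_zero] at h2
      linarith
    · have : IsProbabilityMeasure (P[|A]) := cond_isProbabilityMeasure hA0
      have h2 := measureReal_union_le (μ := P[|A]) F Fᶜ
      -- A `P`-null failure event stays null under conditioning, however small `P A` is.
      rw [Set.union_compl_self, probReal_univ, measureReal_def (P[|A]) Fᶜ,
        cond_absolutelyContinuous hF0, ENNReal.toReal_zero] at h2
      linarith
  rcases Nat.lt_or_ge d 2 with hd | hd
  · refine null ?_
    have hd1 : d = 1 := by
      rcases Nat.eq_zero_or_pos d with rfl | h
      · exact absurd (Subsingleton.elim _ _) hg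
      · omega
    subst hd1
    have : F = Set.univ := Set.eq_univ_of_forall fun ω => OneBit.success_of_dim_one hm hg _
    simp [this]
  rcases le_or_gt Real.pi (OneBit.errorBound 1000 δ g) with he | he
  · exact null (OneBit.measure_not_success_eq_zero hd hm hg hz hi he)
  · have hΔ : 4 * OneBit.deltaCorr g ≤ 1 / 10 := by
      have hD : (1 : ℝ) ≤ √(d : ℝ) := Real.one_le_sqrt.2 (by exact_mod_cast (by omega : 1 ≤ d))
      have h2 := OneBit.deltaCorr_nonneg (g := g)
      have h3 : 0 ≤ (d : ℝ) / √(m : ℝ) * √(Real.log (d / δ)) := by positivity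
      have h4 : 1000 * (√(d : ℝ) * OneBit.deltaCorr g) +
          d / √(m : ℝ) * √(Real.log (d / δ)) < 1 :=
        lt_of_mul_lt_mul_left (by rw [mul_one]; exact he) Real.pi_pos.le
      nlinarith
    refine key _ (1 / 10) (OneBit.measure_not_success_le hd hm hg hz hi h0 h1 he)
      ((OneBit.measure_zeta_ge_le hm hg hz).trans hΔ) (by norm_num) ?_
    linarith
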